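/- Let $N\ge 2$ be an even integer and consider a chain of $N$ spins one, with Hilbert space $(\mathbb{C}^3)^{\otimes N}$, located at the sites $\eta_\alpha=e^{2\pi \mathrm{i}\alpha/N}$ ($\alpha=1,\dots,N$) of the unit circle. Let $\boldsymbol{S}_\alpha=(S^x_\alpha,S^y_\alpha,S^z_\alpha)$ be the spin-one operators on site $\alpha$, $S^\pm_\alpha=S^x_\alpha\pm \mathrm{i}S^y_\alpha$, $\tilde S^+_\alpha=\tfrac12(S^z_\alpha+1)S^+_\alpha$, and let $|{-1}\rangle_N=\bigotimes_{\alpha}|1,-1\rangle_\alpha$ be the state with $S^z_\alpha=-1$ on all sites. Let $$\psi_0(z_1,\dots,z_N)=\mathrm{Pf}\Big(\frac1{z_i-z_j}\Big)\prod_{i<j}(z_i-z_j)\prod_{i=1}^N z_i ,$$ which is a symmetric polynomial in $z_1,\dots,z_N$ (so that it also has a value at coinciding coordinates), and let $$|\psi_0\rangle=\sum_{z_1,\dots,z_N}\psi_0(z_1,\dots,z_N)\,\tilde S^+_{z_1}\cdots\tilde S^+_{z_N}|{-1}\rangle_N ,$$ where each $z_i$ runs independently over the $N$ sites. Then: 1.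 $|\psi_0\rangle\neq0$, and $|\psi_0\rangle$ is an eigenvector of $$H=\frac{2\pi^2}{N^2}\Bigg[\sum_{\alpha\ne\beta}\frac{\boldsymbol{S}_\alpha\cdot\boldsymbol{S}_\beta}{|\eta_\alpha-\eta_\beta|^2}-\frac1{20}\sum_{\substack{\alpha,\beta,\gamma\\ \beta\ne\alpha,\ \gamma\neq\alpha}}\frac{(\boldsymbol{S}_\alpha\cdot\boldsymbol{S}_\beta)(\boldsymbol{S}_\alpha\cdot\boldsymbol{S}_\gamma)+(\boldsymbol{S}_\alpha\cdot\boldsymbol{S}_\gamma)(\boldsymbol{S}_\alpha\cdot\boldsymbol{S}_\beta)}{(\bar\eta_\alpha-\bar\eta_\beta)(\eta_\alpha-\eta_\gamma)}\Bigg]$$ (the terms with $\beta=\gamma$ are included) with eigenvalue $-\dfrac{2\pi^2}{15}\Big(N+\dfrac5N\Big)$. 2. For every $\alpha$, the operator $$\Omega_\alpha=\sum_{\beta\ne\alpha}\frac{(S^-_\alpha)^2S^-_\beta}{\eta_\alpha-\eta_\beta}$$ satisfies $\Omega_\alpha|\psi_0\rangle=0$, and so does the operator $\bar\Omega_\alpha$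 obtained by replacing the coefficients with their complex conjugates. 3. For every $\alpha$, the operator $$\Xi_\alpha=\sum_{\beta\ne\alpha}\sum_{\gamma\ne\alpha}\frac{S^-_\alpha S^-_\beta S^-_\gamma}{(\eta_\alpha-\eta_\beta)(\eta_\alpha-\eta_\gamma)}-\sum_{\beta\neq\alpha}\frac{(S^-_\alpha)^2S^-_\beta}{(\eta_\alpha-\eta_\beta)^2}$$ (the terms with $\beta=\gamma$ are included) satisfies $\Xi_\alpha|\psi_0\rangle=0$, and so does the operator $\bar\Xi_\alpha$ obtained by replacing the coefficients with their complex conjugates. -/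

import Mathlib

open Matrix ComplexConjugate

namespace PfaffianChain

/-! ### The Pfaffian and the wave function -/

/-- The Pfaffian of an (antisymmetric) `2n × 2n` matrix,
`Pf A = (1 / (2ⁿ n!)) ∑_σ sgn σ ∏_k A_{σ(2k), σ(2k+1)}`: the antisymmetrized sum over all
pairings of the indices, each pairing counted once. -/
noncomputable def pfaffian {n : ℕ} (A : Matrix (Fin (2 * n)) (Fin (2 * n)) ℂ) : ℂ :=
  (1 / (2 ^ n * (n.factorial : ℂ))) *
    ∑ σ : Equiv.Perm (Fin (2 * n)), ((Equiv.Perm.sign σ : ℤ) : ℂ) *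
      ∏ k : Fin n, A (σ ⟨2 * k, by omega⟩) (σ ⟨2 * k + 1, by omega⟩)

/-- The Vandermonde product `∏_{i<j} (z_i - z_j)`. -/
noncomputable def vandermondeProd {N : ℕ} (z : Fin N → ℂ) : ℂ :=
  ∏ i, ∏ j ∈ Finset.Ioi i, (z i - z j)

/-- The polynomial `Pf(1/(z_i - z_j)) ∏_{i<j} (z_i - z_j)`. In each term of the Pfaffian the
denominators `z_{σ(2k)} - z_{σ(2k+1)}` are cancelled against the Vandermonde product
(`sgn σ ∏_{i<j} (z_i - z_j) = ∏_{i<j} (z_{σ(i)} - z_{σ(j)})`), so that the expression also has its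
correct value at coinciding coordinates; see `pfaffianVandermonde_eq` for the agreement with the
quotient form at pairwise distinct ones. -/
noncomputable def pfaffianVandermonde {n : ℕ} (z : Fin (2 * n) → ℂ) : ℂ :=
  (1 / (2 ^ n * (n.factorial : ℂ))) *
    ∑ σ : Equiv.Perm (Fin (2 * n)),
      ∏ i : Fin (2 * n), ∏ j ∈ Finset.Ioi i with (i : ℕ) / 2 ≠ (Fin.val j) / 2, (z (σ i) - z (σ j))

/-- The spin liquid wave function
`ψ₀(z₁,…,z_N) = Pf(1/(z_i - z_j)) ∏_{i<j} (z_i - z_j) ∏_i z_i`, with `N = 2n`. -/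
noncomputable def waveFunction {n : ℕ} (z : Fin (2 * n) → ℂ) : ℂ :=
  pfaffianVandermonde z * ∏ i, z i

theorem vandermondeProd_perm {N : ℕ} (z : Fin N → ℂ) (σ : Equiv.Perm (Fin N)) :
    vandermondeProd (fun i => z (σ i)) = ((Equiv.Perm.sign σ : ℤ) : ℂ) * vandermondeProd z := by
  exact σ.prod_Ioi_comp_eq_sign_mul_prod (f := fun i j => z i - z j) (fun i j => by ring)

theorem vandermondeProd_split {n : ℕ} (z : Fin (2 * n) → ℂ) :
    vandermondeProd z =
      (∏ k : Fin n, (z ⟨2 * k, by omega⟩ - z ⟨2 * k + 1, by omega⟩)) *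
      ∏ i : Fin (2 * n), ∏ j ∈ Finset.Ioi i with (i : ℕ) / 2 ≠ (Fin.val j) / 2, (z i - z j) := by
  have h1 : vandermondeProd z =
      (∏ i : Fin (2 * n), ∏ j ∈ Finset.Ioi i with (i : ℕ) / 2 = (Fin.val j) / 2, (z i - z j)) *
      ∏ i : Fin (2 * n), ∏ j ∈ Finset.Ioi i with (i : ℕ) / 2 ≠ (Fin.val j) / 2, (z i - z j) := by
    rw [← Finset.prod_mul_distrib]
    exact Finset.prod_congr rfl fun i _ => (Finset.prod_filter_mul_prod_filter_not _ _ _).symm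
  rw [h1]
  congr 1
  rw [Finset.prod_sigma']
  symm
  refine Finset.prod_bij
    (fun (k : Fin n) _ => (⟨⟨2 * k, by omega⟩, ⟨2 * k + 1, by omega⟩⟩ :
      Σ _ : Fin (2 * n), Fin (2 * n))) ?_ ?_ ?_ ?_
  · intro k _
    simp only [Finset.mem_sigma, Finset.mem_univ, Finset.mem_filter, Finset.mem_Ioi, true_and]
    exact ⟨by simp [Fin.lt_def], by omega⟩
  · intro k _ l _ h
    have h2 := congrArg (fun x : Σ _ : Fin (2 * n), Fin (2 * n) => (x.1 : ℕ)) h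
    simp only at h2
    exact Fin.ext (by omega)
  · rintro ⟨i, j⟩ h
    simp only [Finset.mem_sigma, Finset.mem_univ, Finset.mem_filter, Finset.mem_Ioi, true_and,
      Fin.lt_def] at h
    have hi : 2 * ((i : ℕ) / 2) = i := by omega
    have hj : (i : ℕ) + 1 = j := by omega
    refine ⟨⟨(i : ℕ) / 2, by omega⟩, Finset.mem_univ _, ?_⟩
    simp only [hi, hj]
  · intro k _
    rfl

/-- At pairwise distinct coordinates, `pfaffianVandermonde` is literally
`Pf(1/(z_i - z_j)) ∏_{i<j} (z_i - z_j)`. -/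
theorem pfaffianVandermonde_eq {n : ℕ} (z : Fin (2 * n) → ℂ) (hz : Function.Injective z) :
    pfaffianVandermonde z =
      pfaffian (Matrix.of fun i j => 1 / (z i - z j)) * vandermondeProd z := by
  unfold pfaffianVandermonde pfaffian
  rw [mul_assoc, Finset.sum_mul]
  congr 1
  refine Finset.sum_congr rfl fun σ _ => ?_
  have h := vandermondeProd_perm z σ
  rw [vandermondeProd_split (fun i => z (σ i))] at h
  have hne : (∏ k : Fin n, (z (σ ⟨2 * k, by omega⟩) - z (σ ⟨2 * k + 1, by omega⟩))) ≠ 0 := by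
    refine Finset.prod_ne_zero_iff.mpr fun k _ => sub_ne_zero.mpr fun e => ?_
    simpa [Fin.ext_iff] using σ.injective (hz e)
  simp only [Matrix.of_apply, one_div, Finset.prod_inv_distrib]
  rw [mul_right_comm, ← h, mul_right_comm, mul_inv_cancel₀ hne, one_mul]

/-- `pfaffianVandermonde` is continuous; with `pfaffianVandermonde_eq` this determines it. -/
theorem continuous_pfaffianVandermonde (n : ℕ) :
    Continuous (pfaffianVandermonde : (Fin (2 * n) → ℂ) → ℂ) := by
  unfold pfaffianVandermonde
  fun_prop

/-! ### The chain of `N` spins one -/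

/-- Product basis of `(ℂ³)^{⊗N}`. At each site, `0, 1, 2 : Fin 3` stand for the states
`|1,1⟩, |1,0⟩, |1,-1⟩`. -/
abbrev Config (N : ℕ) := Fin N → Fin 3

/-- State vectors of the chain, by their amplitudes in the product basis. -/
abbrev State (N : ℕ) := Config N → ℂ

/-- Linear operators on the chain, as matrices in the product basis. -/
abbrev Op (N : ℕ) := Matrix (Config N) (Config N) ℂ

/-- The lattice sites `η_α = e^{2πiα/N}` on the unit circle (`α = 0` is the site `α = N`). -/
noncomputable def eta (N : ℕ) (α : Fin N) : ℂ :=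
  Complex.exp (2 * Real.pi * Complex.I * (α : ℕ) / N)

/-- The spin-one matrices. -/
noncomputable def sz : Matrix (Fin 3) (Fin 3) ℂ := !![1, 0, 0; 0, 0, 0; 0, 0, -1]

noncomputable def sp : Matrix (Fin 3) (Fin 3) ℂ :=
  !![0, (Real.sqrt 2 : ℂ), 0; 0, 0, (Real.sqrt 2 : ℂ); 0, 0, 0]

noncomputable def sm : Matrix (Fin 3) (Fin 3) ℂ :=
  !![0, 0, 0; (Real.sqrt 2 : ℂ), 0, 0; 0, (Real.sqrt 2 : ℂ), 0]

noncomputable def sx : Matrix (Fin 3) (Fin 3) ℂ := (1 / 2 : ℂ) • (sp + sm)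

noncomputable def sy : Matrix (Fin 3) (Fin 3) ℂ := (1 / (2 * Complex.I) : ℂ) • (sp - sm)

/-- The one-site operator `A` acting on site `α`, i.e. `1 ⊗ ⋯ ⊗ A ⊗ ⋯ ⊗ 1`. -/
def site {N : ℕ} (α : Fin N) (A : Matrix (Fin 3) (Fin 3) ℂ) : Op N :=
  Matrix.of fun s t => if ∀ β, β ≠ α → s β = t β then A (s α) (t α) else 0

noncomputable def Sx {N : ℕ} (α : Fin N) : Op N := site α sx
noncomputable def Sy {N : ℕ} (α : Fin N) : Op N := site α sy
noncomputable def Sz {N : ℕ} (α : Fin N) : Op N := site α sz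
noncomputable def Sp {N : ℕ} (α : Fin N) : Op N := site α sp
noncomputable def Sm {N : ℕ} (α : Fin N) : Op N := site α sm

/-- The scalar product `𝐒_α · 𝐒_β`. -/
noncomputable def dotS {N : ℕ} (α β : Fin N) : Op N :=
  Sx α * Sx β + Sy α * Sy β + Sz α * Sz β

/-- The renormalized spin flip `S̃⁺_α = ((Sᶻ_α + 1) / 2) S⁺_α`. -/
noncomputable def Stilde {N : ℕ} (α : Fin N) : Op N :=
  ((1 / 2 : ℂ) • (Sz α + 1)) * Sp α

/-- The vacuum `|-1⟩_N = ⊗_α |1,-1⟩_α`. -/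
def vacuum (N : ℕ) : State N := Pi.single (fun _ => 2) 1

/-- The spin liquid state
`|ψ₀⟩ = ∑_{z₁,…,z_N} ψ₀(z₁,…,z_N) S̃⁺_{z₁} ⋯ S̃⁺_{z_N} |-1⟩_N`, where each of the coordinates
`z_i` runs independently over the `N = 2n` lattice sites. -/
noncomputable def psi0 (n : ℕ) : State (2 * n) :=
  ∑ a : Fin (2 * n) → Fin (2 * n),
    waveFunction (fun i => eta (2 * n) (a i)) •
      ((List.ofFn fun i => Stilde (a i)).prod *ᵥ vacuum (2 * n))

/-! ### The operators -/

/-- The Hamiltonian `H^{S=1}`; in the triple sum `β = γ` is allowed. -/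
noncomputable def hamiltonian (N : ℕ) : Op N :=
  (2 * (Real.pi : ℂ) ^ 2 / (N : ℂ) ^ 2) •
    ((∑ α, ∑ β ∈ Finset.univ.erase α,
        (1 / ((‖eta N α - eta N β‖ ^ 2 : ℝ) : ℂ)) • dotS α β) -
      (1 / 20 : ℂ) •
        ∑ α, ∑ β ∈ Finset.univ.erase α, ∑ γ ∈ Finset.univ.erase α,
          (1 / ((conj (eta N α) - conj (eta N β)) * (eta N α - eta N γ))) •
            (dotS α β * dotS α γ + dotS α γ * dotS α β))

/-- `Ω_α = ∑_{β ≠ α} (S⁻_α)² S⁻_β / (η_α - η_β)`. -/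
noncomputable def Omega (N : ℕ) (α : Fin N) : Op N :=
  ∑ β ∈ Finset.univ.erase α, (1 / (eta N α - eta N β)) • (Sm α ^ 2 * Sm β)

/-- `Ω̄_α`: the coefficients of `Ω_α` are replaced by their complex conjugates. -/
noncomputable def OmegaBar (N : ℕ) (α : Fin N) : Op N :=
  ∑ β ∈ Finset.univ.erase α,
    (1 / (conj (eta N α) - conj (eta N β))) • (Sm α ^ 2 * Sm β)

/-- `Ξ_α = ∑_{β,γ ≠ α} S⁻_α S⁻_β S⁻_γ / ((η_α - η_β)(η_α - η_γ))
  - ∑_{β ≠ α} (S⁻_α)² S⁻_β / (η_α - η_β)²`; in the double sum `β = γ` is allowed. -/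
noncomputable def Xi (N : ℕ) (α : Fin N) : Op N :=
  (∑ β ∈ Finset.univ.erase α, ∑ γ ∈ Finset.univ.erase α,
      (1 / ((eta N α - eta N β) * (eta N α - eta N γ))) • (Sm α * Sm β * Sm γ)) -
    ∑ β ∈ Finset.univ.erase α, (1 / (eta N α - eta N β) ^ 2) • (Sm α ^ 2 * Sm β)

/-- `Ξ̄_α`: the coefficients of `Ξ_α` are replaced by their complex conjugates. -/
noncomputable def XiBar (N : ℕ) (α : Fin N) : Op N :=
  (∑ β ∈ Finset.univ.erase α, ∑ γ ∈ Finset.univ.erase α,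
      (1 / ((conj (eta N α) - conj (eta N β)) * (conj (eta N α) - conj (eta N γ)))) •
        (Sm α * Sm β * Sm γ)) -
    ∑ β ∈ Finset.univ.erase α,
      (1 / (conj (eta N α) - conj (eta N β)) ^ 2) • (Sm α ^ 2 * Sm β)

end PfaffianChain

/-!
The amplitudes of `ψ₀` are the values on the lattice of a symmetric polynomial whose exponents in
each variable lie strictly between `0` and `N`, and which vanishes when three variables coincide.
For `0 < k < N` the sums `∑_{β ≠ α} η_β ^ k / (η_α - η_β)` and
`∑_{β ≠ α} η_β ^ k / (η_α - η_β) ^ 2` over roots of unity are polynomials in `k` times a power of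
`η_α`, so that lattice sums act on the polynomial through Euler operators `z ∂`. Each `S⁻` turns one
particle into such a sum, and the amplitudes of `Ω_α ψ₀` and `Ξ_α ψ₀` become combinations of
derivatives at a point where three variables coincide. By symmetry, the first derivatives and
`(z_i ∂_i) ^ 2 + 2 z_i ∂_i z_j ∂_j` vanish there, and only these occur.

For the Hamiltonian, `ψ₀` is a singlet, so that with `𝐊 = ∑_{β ≠ α} w_β 𝐒_β` the vectors `K_a φ_b`
built from the Cartesian components `φ_b` of the spin at `α` split into parts of spin `0`, `1` and
`2`. The state `(S⁻_α)² K⁻ ψ₀` is the extreme component of the spin-two part, hence `Ω_α ψ₀ = 0`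
removes that part, and then `(𝐒_α · 𝐊)(𝐒_α · 𝐋) ψ₀ = 4 (𝐊 · 𝐋) ψ₀ + 2 (𝐒_α · 𝐌) ψ₀` for
`𝐊 × 𝐋 = i 𝐌`. This turns the three-site terms into two-site ones, whose coefficients are again
sums over the lattice; what survives is a constant and the square of the total spin.
-/

namespace PfaffianChain

/-! ### One-site operators -/

section Site

variable {N : ℕ}

theorem site_mulVec (α : Fin N) (A : Matrix (Fin 3) (Fin 3) ℂ) (f : State N) (s : Config N) :
    (site α A *ᵥ f) s = ∑ m, A (s α) m * f (Function.update s α m) := by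
  classical
  symm
  simp only [mulVec, dotProduct, site, of_apply, ite_mul, zero_mul]
  refine Fintype.sum_of_injective (Function.update s α) (Function.update_injective s α) _ _
    (fun t ht => if_neg fun h => ht ⟨t α, ?_⟩) fun m => ?_
  · exact Function.update_eq_iff.mpr ⟨rfl, h⟩
  · rw [if_pos fun β hβ => (Function.update_of_ne hβ ..).symm, Function.update_self]

theorem op_ext {A B : Op N} (h : ∀ f s, (A *ᵥ f) s = (B *ᵥ f) s) : A = B :=
  mulVec_injective (funext fun f => funext (h f))

theorem site_mul (α : Fin N) (A B : Matrix (Fin 3) (Fin 3) ℂ) :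
    site α A * site α B = site α (A * B) := by
  refine op_ext fun f s => ?_
  rw [← mulVec_mulVec]
  simp only [site_mulVec, Function.update_self, Function.update_idem, mul_apply,
    Finset.mul_sum, Finset.sum_mul]
  rw [Finset.sum_comm]
  simp only [mul_assoc]

theorem site_add (α : Fin N) (A B : Matrix (Fin 3) (Fin 3) ℂ) :
    site α (A + B) = site α A + site α B := by
  refine op_ext fun f s => ?_
  simp only [add_mulVec, Pi.add_apply, site_mulVec, Matrix.add_apply, add_mul,
    Finset.sum_add_distrib]

theorem site_sub (α : Fin N) (A B : Matrix (Fin 3) (Fin 3) ℂ) :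
    site α (A - B) = site α A - site α B := by
  refine op_ext fun f s => ?_
  simp only [sub_mulVec, Pi.sub_apply, site_mulVec, Matrix.sub_apply, sub_mul,
    Finset.sum_sub_distrib]

theorem site_smul (α : Fin N) (c : ℂ) (A : Matrix (Fin 3) (Fin 3) ℂ) :
    site α (c • A) = c • site α A := by
  refine op_ext fun f s => ?_
  simp only [smul_mulVec, Pi.smul_apply, site_mulVec, Matrix.smul_apply, smul_eq_mul, mul_assoc,
    Finset.mul_sum]

theorem site_zero (α : Fin N) : site α (0 : Matrix (Fin 3) (Fin 3) ℂ) = 0 := by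
  rw [← sub_self 0, site_sub, sub_self]

theorem site_one (α : Fin N) : site α (1 : Matrix (Fin 3) (Fin 3) ℂ) = (1 : Op N) := by
  refine op_ext fun f s => ?_
  simp [site_mulVec, one_apply]

theorem site_commute {α β : Fin N} (h : α ≠ β) (A B : Matrix (Fin 3) (Fin 3) ℂ) :
    Commute (site α A) (site β B) := by
  refine op_ext fun f s => ?_
  simp only [← mulVec_mulVec, site_mulVec, Function.update_of_ne h, Function.update_of_ne h.symm,
    Finset.mul_sum, Function.update_comm h]
  rw [Finset.sum_comm]
  simp only [mul_left_comm]

theorem site_conjTranspose (α : Fin N) (A : Matrix (Fin 3) (Fin 3) ℂ) :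
    (site α A)ᴴ = site α Aᴴ := by
  ext s t
  simp only [site, conjTranspose_apply, of_apply, eq_comm (a := t _), apply_ite star, star_zero]

end Site

/-! ### Product states -/

section ProdState

variable {N : ℕ}

/-- The product state with the one-site state `g α` at the site `α`, as a multilinear function of
the one-site states. -/
def prodState : MultilinearMap ℂ (fun _ : Fin N => Fin 3 → ℂ) (State N) :=
  MultilinearMap.pi fun s =>
    (MultilinearMap.mkPiAlgebra ℂ (Fin N) ℂ).compLinearMap fun α => LinearMap.proj (s α)

theorem prodState_apply (g : Fin N → Fin 3 → ℂ) (s : Config N) :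
    prodState g s = ∏ α, g α (s α) := rfl

theorem site_mulVec_prodState (α : Fin N) (A : Matrix (Fin 3) (Fin 3) ℂ)
    (g : Fin N → Fin 3 → ℂ) :
    site α A *ᵥ prodState g = prodState (Function.update g α (A *ᵥ g α)) := by
  ext s
  have split (h : Fin N → Fin 3 → ℂ) (t : Config N) :
      prodState h t = h α (t α) * ∏ β ∈ Finset.univ.erase α, h β (t β) :=
    (Finset.mul_prod_erase _ _ (Finset.mem_univ α)).symm
  have off_site (v : Fin 3 → ℂ) (m : Fin 3) :
      ∏ β ∈ Finset.univ.erase α, Function.update g α v β (Function.update s α m β) =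
        ∏ β ∈ Finset.univ.erase α, g β (s β) :=
    Finset.prod_congr rfl fun β hβ => by
      simp only [Function.update_of_ne (Finset.ne_of_mem_erase hβ)]
  have h₁ := fun m => off_site (g α) m
  have h₂ := off_site (A *ᵥ g α) (s α)
  simp only [Function.update_eq_self] at h₁ h₂
  rw [site_mulVec]
  simp only [split, h₁, h₂, Function.update_self, mulVec, dotProduct, Finset.sum_mul, mul_assoc]

/-- The one-site renormalized spin flip. -/
noncomputable def stilde : Matrix (Fin 3) (Fin 3) ℂ := ((1 / 2 : ℂ) • (sz + 1)) * sp

theorem Stilde_eq_site (α : Fin N) : Stilde α = site α stilde := by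
  rw [Stilde, stilde, ← site_mul, site_smul, site_add, site_one, Sz, Sp]

theorem sqrt_two_mul_self : (Real.sqrt 2 : ℂ) * (Real.sqrt 2 : ℂ) = 2 := by
  exact_mod_cast Real.mul_self_sqrt zero_le_two

theorem stilde_eq : stilde =
    !![0, (Real.sqrt 2 : ℂ), 0; 0, 0, (Real.sqrt 2 : ℂ) / 2; 0, 0, 0] := by
  ext i j
  fin_cases i <;> fin_cases j <;>
    simp [stilde, sz, sp, mul_apply, Fin.sum_univ_three, one_apply] <;> ring

/-- The one-site state with `k` flips applied to `|1,-1⟩`. -/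
noncomputable def flipped (k : ℕ) : Fin 3 → ℂ := stilde ^ k *ᵥ Pi.single 2 1

theorem stilde_mulVec_flipped (k : ℕ) : stilde *ᵥ flipped k = flipped (k + 1) := by
  rw [flipped, flipped, pow_succ', mulVec_mulVec]

theorem flipped_zero : flipped 0 = ![0, 0, 1] := by
  ext i; fin_cases i <;> simp [flipped]

theorem flipped_one : flipped 1 = ![0, (Real.sqrt 2 : ℂ) / 2, 0] := by
  rw [← stilde_mulVec_flipped, flipped_zero, stilde_eq]
  ext i; fin_cases i <;> simp [vecHead]

theorem flipped_two : flipped 2 = ![1, 0, 0] := by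
  rw [← stilde_mulVec_flipped, flipped_one, stilde_eq]
  ext i; fin_cases i <;> simp [vecHead, vecTail]
  linear_combination (1 / 2 : ℂ) * sqrt_two_mul_self

theorem flipped_add_three (k : ℕ) : flipped (k + 3) = 0 := by
  induction k with
  | zero =>
    rw [← stilde_mulVec_flipped, flipped_two, stilde_eq]
    ext i; fin_cases i <;> simp [vecHead]
  | succ k ih => rw [Nat.add_right_comm, ← stilde_mulVec_flipped, ih, mulVec_zero]

theorem sz_mulVec_flipped : ∀ k : ℕ, sz *ᵥ flipped k = ((k : ℂ) - 1) • flipped k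
  | 0 => by
    rw [flipped_zero]
    ext i; fin_cases i <;> simp [sz, vecHead]
  | 1 => by
    rw [flipped_one]
    ext i; fin_cases i <;> simp [sz, vecHead, vecTail]
  | 2 => by
    rw [flipped_two]
    ext i; fin_cases i <;> simp [sz, vecHead]
    norm_num
  | k + 3 => by simp only [flipped_add_three, mulVec_zero, smul_zero]

theorem sm_mulVec_flipped_zero : sm *ᵥ flipped 0 = 0 := by
  rw [flipped_zero]
  ext i; fin_cases i <;> simp [sm, vecHead]

theorem sm_mulVec_flipped_succ : ∀ k < 2, sm *ᵥ flipped (k + 1) = ((k : ℂ) + 1) • flipped k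
  | 0, _ => by
    rw [flipped_zero, zero_add, flipped_one]
    ext i; fin_cases i <;> simp [sm, vecHead, vecTail]
    linear_combination (1 / 2 : ℂ) * sqrt_two_mul_self
  | 1, _ => by
    rw [flipped_one, one_add_one_eq_two, flipped_two]
    ext i; fin_cases i <;> simp [sm, vecHead]
    ring

end ProdState

/-! ### States defined by wave functions -/

section Ket

variable {N M : ℕ}

/-- The number of particles at the site `α` when the `i`-th particle sits at `a i`. -/
def occ (a : Fin M → Fin N) (α : Fin N) : ℕ := Finset.card {i | a i = α}

theorem occ_eq_add_removeNth (a : Fin (M + 1) → Fin N) (i : Fin (M + 1)) (α : Fin N) :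
    occ a α = (if a i = α then 1 else 0) + occ (i.removeNth a) α := by
  simp only [occ, Finset.card_filter]
  exact Fin.sum_univ_succAbove (fun j => if a j = α then 1 else 0) i

theorem sum_occ (a : Fin M → Fin N) : ∑ α, occ a α = M := by
  simpa [occ] using
    (Finset.card_eq_sum_card_fiberwise (f := a) (s := .univ) (t := .univ) (by simp)).symm

/-- The state `S̃⁺_{a 0} ⋯ S̃⁺_{a (M-1)} |-1⟩` with particles at the sites `a i`. -/
noncomputable def flipState (a : Fin M → Fin N) : State N :=
  (List.ofFn fun i => Stilde (a i)).prod *ᵥ vacuum N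

theorem vacuum_eq_prodState : vacuum N = prodState fun _ => flipped 0 := by
  ext s
  simp only [vacuum, prodState_apply, flipped, pow_zero, one_mulVec, Pi.single_apply,
    Fintype.prod_ite_zero, Finset.prod_const_one, funext_iff]

theorem flipState_eq_prodState (a : Fin M → Fin N) :
    flipState a = prodState fun α => flipped (occ a α) := by
  induction M with
  | zero => simp [flipState, vacuum_eq_prodState, occ]
  | succ M ih =>
    have h_tail := ih (Fin.removeNth 0 a)
    rw [flipState] at h_tail ⊢
    rw [List.ofFn_succ, List.prod_cons, ← mulVec_mulVec]
    change Stilde (a 0) *ᵥ ((List.ofFn fun i => Stilde (Fin.removeNth 0 a i)).prod *ᵥ _) = _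
    rw [h_tail, Stilde_eq_site, site_mulVec_prodState]
    congr 1 with α : 1
    rcases eq_or_ne α (a 0) with rfl | hα
    · rw [Function.update_self, stilde_mulVec_flipped, occ_eq_add_removeNth a 0, if_pos rfl,
        add_comm]
    · rw [Function.update_of_ne hα, occ_eq_add_removeNth a 0, if_neg hα.symm, zero_add]

theorem flipState_removeNth (a : Fin (M + 1) → Fin N) (i : Fin (M + 1)) :
    flipState (i.removeNth a) =
      prodState (Function.update (fun β => flipped (occ a β)) (a i)
        (flipped (occ a (a i) - 1))) := by
  rw [flipState_eq_prodState]
  congr 1 with β : 1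
  rcases eq_or_ne β (a i) with rfl | hβ
  · rw [Function.update_self, occ_eq_add_removeNth a i, if_pos rfl, Nat.add_sub_cancel_left]
  · rw [Function.update_of_ne hβ, occ_eq_add_removeNth a i, if_neg hβ.symm, zero_add]

theorem Sm_mulVec_flipState_of_occ_eq_zero {α : Fin N} {a : Fin M → Fin N} (ha : occ a α = 0) :
    Sm α *ᵥ flipState a = 0 := by
  rw [flipState_eq_prodState, Sm, site_mulVec_prodState, ha, sm_mulVec_flipped_zero]
  exact prodState.map_update_zero _ α

theorem Sm_mulVec_flipState {α : Fin N} {a : Fin (M + 1) → Fin N} (ha : occ a α ≤ 2) :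
    Sm α *ᵥ flipState a = ∑ i with a i = α, flipState (i.removeNth a) := by
  rw [Finset.sum_congr rfl fun i hi => by
    rw [flipState_removeNth, (Finset.mem_filter.mp hi).2], Finset.sum_const]
  change _ = occ a α • _
  rcases hk : occ a α with _ | k
  · rw [zero_smul, Sm_mulVec_flipState_of_occ_eq_zero hk]
  · rw [flipState_eq_prodState, Sm, site_mulVec_prodState, hk,
      sm_mulVec_flipped_succ k (by omega), prodState.map_update_smul, ← Nat.cast_succ,
      Nat.cast_smul_eq_nsmul, Nat.add_sub_cancel]

theorem Sz_mulVec_flipState (α : Fin N) (a : Fin M → Fin N) :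
    Sz α *ᵥ flipState a = ((occ a α : ℂ) - 1) • flipState a := by
  rw [flipState_eq_prodState, Sz, site_mulVec_prodState, sz_mulVec_flipped,
    prodState.map_update_smul, Function.update_eq_self α fun β => flipped (occ a β)]

/-- The state of `M` particles with the (not necessarily symmetric) wave function `ψ`. -/
noncomputable def ket : ((Fin M → Fin N) → ℂ) →ₗ[ℂ] State N :=
  Fintype.linearCombination ℂ flipState

theorem ket_apply (ψ : (Fin M → Fin N) → ℂ) : ket ψ = ∑ a, ψ a • flipState a := rfl

theorem sum_Sz_mulVec_ket (ψ : (Fin M → Fin N) → ℂ) :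
    (∑ α, Sz α) *ᵥ ket ψ = ((M : ℂ) - N) • ket ψ := by
  simp only [ket_apply, mulVec_sum, mulVec_smul, sum_mulVec, Sz_mulVec_flipState, ← Finset.sum_smul,
    Finset.smul_sum]
  refine Finset.sum_congr rfl fun a _ => ?_
  rw [Finset.sum_sub_distrib, ← Nat.cast_sum, sum_occ, Finset.sum_const,
    Finset.card_univ, Fintype.card_fin, nsmul_one, smul_comm]

/-- Symmetric wave functions that vanish if three coordinates coincide. -/
structure IsAdmissible (ψ : (Fin M → Fin N) → ℂ) : Prop where
  symm : ∀ (σ : Equiv.Perm (Fin M)) a, ψ (a ∘ σ) = ψ a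
  triple : ∀ a α, 3 ≤ occ a α → ψ a = 0

namespace IsAdmissible

variable {ψ : (Fin (M + 1) → Fin N) → ℂ} (h : IsAdmissible ψ)
include h

theorem insertNth_eq_cons (i : Fin (M + 1)) (α : Fin N) (b : Fin M → Fin N) :
    ψ (i.insertNth α b) = ψ (Fin.cons α b) := by
  rw [← h.symm i.cycleRange.symm, ← Fin.insertNth_zero']
  congr 1 with j
  refine Fin.cases ?_ (fun k => ?_) j <;> simp

theorem cons (α : Fin N) : IsAdmissible fun b : Fin M → Fin N => ψ (Fin.cons α b) where
  symm σ b := by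
    rw [← h.symm (Equiv.Perm.decomposeFin.symm (0, σ)) (Fin.cons α b)]
    congr 1 with i
    refine Fin.cases ?_ (fun j => ?_) i <;> simp
  triple b β hb := by
    refine h.triple _ β ?_
    rw [occ_eq_add_removeNth _ 0]
    exact le_add_left hb

end IsAdmissible

theorem Sm_mulVec_ket_zero (α : Fin N) (ψ : (Fin 0 → Fin N) → ℂ) : Sm α *ᵥ ket ψ = 0 := by
  simp only [ket_apply, mulVec_sum, mulVec_smul]
  refine Finset.sum_eq_zero fun a _ => ?_
  rw [Sm_mulVec_flipState_of_occ_eq_zero (by simp [occ]), smul_zero]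

theorem Sm_mulVec_ket {ψ : (Fin (M + 1) → Fin N) → ℂ} (h : IsAdmissible ψ) (α : Fin N) :
    Sm α *ᵥ ket ψ = ((M : ℂ) + 1) • ket fun b => ψ (Fin.cons α b) := by
  have lower (a : Fin (M + 1) → Fin N) : ψ a • (Sm α *ᵥ flipState a) =
      ∑ i, if a i = α then ψ a • flipState (i.removeNth a) else 0 := by
    rcases le_or_gt (occ a α) 2 with ha | ha
    · rw [Sm_mulVec_flipState ha, Finset.smul_sum, Finset.sum_filter]
    · simp only [h.triple a α ha, zero_smul, ite_self, Finset.sum_const_zero]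
  have fix_coordinate (i : Fin (M + 1)) :
      (∑ a : Fin (M + 1) → Fin N, if a i = α then ψ a • flipState (i.removeNth a) else 0) =
        ket fun b => ψ (Fin.cons α b) := by
    symm
    have insert_injective : Function.Injective (i.insertNth (α := fun _ => Fin N) α) :=
      Fin.insertNth_right_injective (α := fun _ => Fin N) α
    refine Fintype.sum_of_injective _ insert_injective _ _
      (fun a ha => if_neg fun hi => ha ⟨i.removeNth a, ?_⟩) fun b => ?_
    · rw [← hi, Fin.insertNth_self_removeNth]
    · rw [Fin.insertNth_apply_same, if_pos rfl, Fin.removeNth_insertNth, h.insertNth_eq_cons]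
  rw [ket_apply, mulVec_sum]
  simp only [mulVec_smul, lower]
  rw [Finset.sum_comm, Finset.sum_congr rfl fun i _ => fix_coordinate i, Finset.sum_const,
    Finset.card_univ, Fintype.card_fin, ← Nat.cast_succ, Nat.cast_smul_eq_nsmul]

theorem IsAdmissible.eq_zero_of_ket_eq_zero {ψ : (Fin M → Fin N) → ℂ}
    (h : IsAdmissible ψ) (h₀ : ket ψ = 0) (a : Fin M → Fin N) : ψ a = 0 := by
  induction M with
  | zero =>
    have h_amp := congrFun h₀ fun _ => 2
    simpa [ket_apply, flipState_eq_prodState, prodState_apply, occ, flipped_zero,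
      Subsingleton.elim default a] using h_amp
  | succ M ih =>
    rw [← Fin.cons_self_tail a]
    refine ih (h.cons (a 0)) ?_ (Fin.tail a)
    have h_lower := Sm_mulVec_ket h (a 0)
    rw [h₀, mulVec_zero] at h_lower
    exact (smul_eq_zero.mp h_lower.symm).resolve_left (Nat.cast_add_one_ne_zero M)

end Ket

/-! ### The wave function as a polynomial -/

section BlockProd

variable {n : ℕ} {R S : Type*} [CommRing R] [CommRing S]

/-- The pair `{2k, 2k + 1}` of positions that `i` belongs to, recorded by `k`. -/
def block (i : Fin (2 * n)) : Fin n := ⟨(i : ℕ) / 2, by omega⟩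

theorem block_inj {i j : Fin (2 * n)} : block i = block j ↔ (i : ℕ) / 2 = (j : ℕ) / 2 :=
  Fin.ext_iff

theorem card_filter_block_eq (k : Fin n) : Finset.card {i : Fin (2 * n) | block i = k} = 2 := by
  refine Finset.card_eq_two.mpr ⟨⟨2 * k, by omega⟩, ⟨2 * k + 1, by omega⟩, by simp, ?_⟩
  ext i
  simp only [Finset.mem_filter, Finset.mem_univ, true_and, block, Fin.ext_iff, Finset.mem_insert,
    Finset.mem_singleton]
  omega

theorem card_filter_block_ne (k : Fin n) :
    Finset.card {i : Fin (2 * n) | block i ≠ k} = 2 * n - 2 := by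
  rw [Finset.filter_not, Finset.card_univ_sdiff, card_filter_block_eq, Fintype.card_fin]

theorem prod_comp_block {M : Type*} [CommMonoid M] (G : Fin n → M) :
    ∏ i : Fin (2 * n), G (block i) = (∏ k, G k) ^ 2 := by
  simp only [← Finset.prod_fiberwise' Finset.univ block, Finset.prod_const, card_filter_block_eq,
    Finset.prod_pow]

/-- The Vandermonde product `∏_{i<j} (y_i - y_j)` without the factors that belong to the pairs
`{2k, 2k + 1}`: a term of `pfaffianVandermonde`, with entries in any commutative ring. -/
def blockProd (y : Fin (2 * n) → R) : R :=
  ∏ i : Fin (2 * n), ∏ j ∈ Finset.Ioi i with (i : ℕ) / 2 ≠ (Fin.val j) / 2, (y i - y j)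

theorem pfaffianVandermonde_eq_sum_blockProd (z : Fin (2 * n) → ℂ) :
    pfaffianVandermonde z = (1 / (2 ^ n * (n.factorial : ℂ))) *
      ∑ σ : Equiv.Perm (Fin (2 * n)), blockProd (z ∘ σ) := rfl

theorem map_blockProd (f : R →+* S) (y : Fin (2 * n) → R) :
    f (blockProd y) = blockProd (f ∘ y) := by
  simp only [blockProd, map_prod, map_sub, Function.comp_apply]

theorem blockProd_eq_zero {y : Fin (2 * n) → R} {p q : Fin (2 * n)} (hpq : block p ≠ block q)
    (hy : y p = y q) : blockProd y = 0 := by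
  wlog hlt : p < q generalizing p q
  · refine this hpq.symm hy.symm (lt_of_le_of_ne (not_lt.mp hlt) ?_)
    rintro rfl
    exact hpq rfl
  refine Finset.prod_eq_zero (Finset.mem_univ p) (Finset.prod_eq_zero (i := q) ?_ ?_)
  · exact Finset.mem_filter.mpr ⟨Finset.mem_Ioi.mpr hlt, mt block_inj.mpr hpq⟩
  · rw [hy, sub_self]

theorem vandermondeProd_eq_prod_ite (y : Fin n → ℂ) :
    vandermondeProd y = ∏ k, ∏ l, if k < l then y k - y l else 1 := by
  simp only [vandermondeProd, ← Finset.prod_filter, Finset.filter_lt_eq_Ioi]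

theorem blockProd_comp_block (x : Fin n → ℂ) :
    blockProd (x ∘ block) = vandermondeProd x ^ 4 := by
  have inner (i : Fin (2 * n)) :
      ∏ j ∈ Finset.Ioi i with (i : ℕ) / 2 ≠ (Fin.val j) / 2,
          ((x ∘ block) i - (x ∘ block) j) =
        (∏ l, if block i < l then x (block i) - x l else 1) ^ 2 := by
    rw [← prod_comp_block, ← Finset.prod_filter]
    refine Finset.prod_congr (Finset.ext fun j => ?_) fun _ _ => rfl
    simp only [Finset.mem_filter, Finset.mem_univ, true_and, Finset.mem_Ioi, block, Fin.lt_def]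
    omega
  simp only [blockProd, inner]
  rw [prod_comp_block (fun k => (∏ l, if k < l then x k - x l else 1) ^ 2), Finset.prod_pow,
    ← vandermondeProd_eq_prod_ite, ← pow_mul]

theorem exists_perm_block_apply_eq {σ : Equiv.Perm (Fin (2 * n))}
    (hσ : ∀ p q, block (σ p) = block (σ q) → block p = block q) :
    ∃ τ : Equiv.Perm (Fin n), ∀ i, block (σ i) = τ (block i) := by
  let first (k : Fin n) : Fin (2 * n) := ⟨2 * k, by omega⟩
  have block_first (k : Fin n) : block (first k) = k := Fin.ext (by simp [block, first])
  have h_inj : Function.Injective fun k => block (σ (first k)) := fun k l hkl => by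
    simpa only [block_first] using hσ _ _ hkl
  refine ⟨Equiv.ofBijective _ (Finite.injective_iff_bijective.mp h_inj), fun i => ?_⟩
  obtain ⟨m, hm⟩ := Finite.surjective_of_injective h_inj (block (σ i))
  have h_block := hσ _ _ hm
  rw [block_first] at h_block
  rw [← h_block]
  exact hm.symm

theorem blockProd_comp_block_comp_perm (x : Fin n → ℂ) (σ : Equiv.Perm (Fin (2 * n))) :
    blockProd (x ∘ block ∘ σ) = 0 ∨ blockProd (x ∘ block ∘ σ) = vandermondeProd x ^ 4 := by
  by_cases hσ : ∀ p q, block (σ p) = block (σ q) → block p = block q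
  · obtain ⟨τ, hτ⟩ := exists_perm_block_apply_eq hσ
    have h_comp : x ∘ block ∘ σ = (x ∘ τ) ∘ block := funext fun i => congrArg x (hτ i)
    have h_sign : ((Equiv.Perm.sign τ : ℤ) : ℂ) ^ 4 = 1 := by
      rcases Int.units_eq_one_or (Equiv.Perm.sign τ) with h | h <;> norm_num [h]
    right
    rw [h_comp, blockProd_comp_block, ← one_mul (vandermondeProd x ^ 4), ← h_sign, ← mul_pow]
    exact congrArg (· ^ 4) (vandermondeProd_perm x τ)
  · push Not at hσ
    obtain ⟨p, q, h_eq, h_ne⟩ := hσ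
    exact Or.inl (blockProd_eq_zero h_ne (congrArg x h_eq))

end BlockProd

section WaveFunction

variable {n : ℕ}

theorem pfaffianVandermonde_comp_perm (z : Fin (2 * n) → ℂ) (τ : Equiv.Perm (Fin (2 * n))) :
    pfaffianVandermonde (z ∘ τ) = pfaffianVandermonde z := by
  simp only [pfaffianVandermonde_eq_sum_blockProd]
  congr 1
  exact Equiv.sum_comp (Equiv.mulLeft τ) fun σ => blockProd (z ∘ σ)

theorem waveFunction_comp_perm (z : Fin (2 * n) → ℂ) (τ : Equiv.Perm (Fin (2 * n))) :
    waveFunction (z ∘ τ) = waveFunction z := by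
  rw [waveFunction, pfaffianVandermonde_comp_perm, waveFunction]
  exact congrArg _ (Equiv.prod_comp τ z)

theorem waveFunction_eq_zero {z : Fin (2 * n) → ℂ} {i j k : Fin (2 * n)} (hij : i ≠ j)
    (hik : i ≠ k) (hjk : j ≠ k) (h_ij : z i = z j) (h_ik : z i = z k) : waveFunction z = 0 := by
  rw [waveFunction, pfaffianVandermonde_eq_sum_blockProd, Finset.sum_eq_zero, mul_zero, zero_mul]
  intro σ _
  have h_block : block (σ.symm i) ≠ block (σ.symm j) ∨ block (σ.symm i) ≠ block (σ.symm k) := by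
    have hij' := Fin.val_ne_iff.mpr (σ.symm.injective.ne hij)
    have hik' := Fin.val_ne_iff.mpr (σ.symm.injective.ne hik)
    have hjk' := Fin.val_ne_iff.mpr (σ.symm.injective.ne hjk)
    simp only [ne_eq, block_inj]
    omega
  rcases h_block with h | h
  · exact blockProd_eq_zero h (by simpa using h_ij)
  · exact blockProd_eq_zero h (by simpa using h_ik)

theorem vandermondeProd_ne_zero {x : Fin n → ℂ} (hx : Function.Injective x) :
    vandermondeProd x ≠ 0 :=
  Finset.prod_ne_zero_iff.mpr fun _ _ => Finset.prod_ne_zero_iff.mpr fun _ hj =>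
    sub_ne_zero.mpr (hx.ne (Finset.mem_Ioi.mp hj).ne)

theorem waveFunction_comp_block_ne_zero {x : Fin n → ℂ} (hx : Function.Injective x)
    (hx₀ : ∀ k, x k ≠ 0) : waveFunction (x ∘ block) ≠ 0 := by
  have hV : vandermondeProd x ^ 4 ≠ 0 := pow_ne_zero _ (vandermondeProd_ne_zero hx)
  have h_sum : ∑ σ : Equiv.Perm (Fin (2 * n)), blockProd (x ∘ block ∘ σ) =
      (Finset.card {σ : Equiv.Perm (Fin (2 * n)) | blockProd (x ∘ block ∘ σ) ≠ 0} : ℂ) *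
        vandermondeProd x ^ 4 := by
    rw [← nsmul_eq_mul, ← Finset.sum_const, Finset.sum_filter]
    refine Finset.sum_congr rfl fun σ _ => ?_
    rcases blockProd_comp_block_comp_perm x σ with h | h
    · rw [h, if_neg (not_not_intro rfl)]
    · rw [h, if_pos hV]
  have h_id : blockProd (x ∘ block ∘ (1 : Equiv.Perm (Fin (2 * n)))) ≠ 0 := by
    rw [Equiv.Perm.coe_one, Function.comp_id, blockProd_comp_block]
    exact hV
  have h_card : (Finset.card {σ : Equiv.Perm (Fin (2 * n)) |
      blockProd (x ∘ block ∘ σ) ≠ 0} : ℂ) ≠ 0 :=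
    Nat.cast_ne_zero.mpr (Finset.card_ne_zero_of_mem
      (Finset.mem_filter.mpr ⟨Finset.mem_univ 1, h_id⟩))
  have h_norm : (2 ^ n * n.factorial : ℂ) ≠ 0 :=
    mul_ne_zero (pow_ne_zero _ two_ne_zero) (Nat.cast_ne_zero.mpr n.factorial_ne_zero)
  refine mul_ne_zero ?_ (Finset.prod_ne_zero_iff.mpr fun i _ => hx₀ _)
  rw [pfaffianVandermonde_eq_sum_blockProd]
  exact mul_ne_zero (one_div_ne_zero h_norm) (h_sum ▸ mul_ne_zero h_card hV)

end WaveFunction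

section WavePoly

open MvPolynomial

variable {n : ℕ}

theorem sum_Ioi_ite_add_ite {ι : Type*} [Fintype ι] [LinearOrder ι] [LocallyFiniteOrderTop ι]
    [LocallyFiniteOrderBot ι] (r : ι → ι → Prop) [DecidableRel r] (h_symm : ∀ i j, r i j → r j i)
    (h_irrefl : ∀ i, ¬ r i i) (p : ι) :
    ∑ i, ∑ j ∈ Finset.Ioi i with r i j, ((if p = i then 1 else 0) + if p = j then 1 else 0) =
      Finset.card {q | r p q} := by
  let f (i j : ι) : ℕ := if r i j ∧ p = i then 1 else 0
  calc _ = ∑ i, ∑ j ∈ Finset.Ioi i, (f j i + f i j) :=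
        Finset.sum_congr rfl fun i _ => by
          rw [Finset.sum_filter]
          refine Finset.sum_congr rfl fun j _ => ?_
          have h_comm : r j i ↔ r i j := ⟨h_symm j i, h_symm i j⟩
          by_cases hr : r i j <;> simp [f, hr, h_comm, add_comm]
    _ = ∑ i, ∑ j ∈ {i}ᶜ, f j i := Finset.sum_sum_Ioi_add_eq_sum_sum_off_diag f
    _ = ∑ i, if r p i then 1 else 0 := by
        refine Finset.sum_congr rfl fun i _ => ?_
        refine (Finset.sum_eq_single p (fun j _ hj => if_neg fun h => hj h.2.symm) fun hp =>
          if_neg fun h => hp ?_).trans (by simp only [and_true])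
        rw [Finset.mem_compl, Finset.mem_singleton]
        rintro rfl
        exact h_irrefl p h.1
    _ = _ := (Finset.card_filter _ _).symm

theorem degreeOf_blockProd_X_le (R : Type*) [CommRing R] [Nontrivial R]
    (p : Fin (2 * n)) :
    degreeOf p (blockProd X : MvPolynomial (Fin (2 * n)) R) ≤ 2 * n - 2 := by
  have factor_le (i j : Fin (2 * n)) : degreeOf p (X i - X j : MvPolynomial (Fin (2 * n)) R) ≤
      (if p = i then 1 else 0) + if p = j then 1 else 0 := by
    refine (degreeOf_sub_le _ _ _).trans ?_
    rw [degreeOf_X, degreeOf_X]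
    exact max_le (Nat.le_add_right _ _) (Nat.le_add_left _ _)
  calc _ ≤ ∑ i : Fin (2 * n), ∑ j ∈ Finset.Ioi i with (i : ℕ) / 2 ≠ (Fin.val j) / 2,
          ((if p = i then 1 else 0) + if p = j then 1 else 0) :=
        (degreeOf_prod_le _ _ _).trans (Finset.sum_le_sum fun i _ =>
          (degreeOf_prod_le _ _ _).trans (Finset.sum_le_sum fun j _ => factor_le i j))
    _ = Finset.card {q | block q ≠ block p} := by
        simp only [ne_eq, ← block_inj, eq_comm (b := block p)]
        exact sum_Ioi_ite_add_ite (fun i j : Fin (2 * n) => block i ≠ block j)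
          (fun _ _ => Ne.symm) (fun _ => not_not_intro rfl) p
    _ = 2 * n - 2 := card_filter_block_ne _

/-- `pfaffianVandermonde` as a polynomial. -/
noncomputable def pfaffianPoly (n : ℕ) : MvPolynomial (Fin (2 * n)) ℂ :=
  C (1 / (2 ^ n * (n.factorial : ℂ))) * ∑ σ : Equiv.Perm (Fin (2 * n)), blockProd (X ∘ σ)

theorem eval_pfaffianPoly (z : Fin (2 * n) → ℂ) :
    eval z (pfaffianPoly n) = pfaffianVandermonde z := by
  simp only [pfaffianPoly, pfaffianVandermonde_eq_sum_blockProd, map_mul, map_sum, eval_C,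
    map_blockProd]
  simp only [Function.comp_def, eval_X]

theorem degreeOf_pfaffianPoly_le (i : Fin (2 * n)) : degreeOf i (pfaffianPoly n) ≤ 2 * n - 2 := by
  refine (degreeOf_C_mul_le _ _ _).trans
    ((degreeOf_sum_le _ _ _).trans (Finset.sup_le fun σ _ => ?_))
  have h_rename : (blockProd (X ∘ σ) : MvPolynomial (Fin (2 * n)) ℂ) =
      rename σ (blockProd X) := by
    rw [← AlgHom.coe_toRingHom, map_blockProd]
    simp only [Function.comp_def, AlgHom.coe_toRingHom, rename_X]
  rw [h_rename, ← σ.apply_symm_apply i, degreeOf_rename_of_injective σ.injective]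
  exact degreeOf_blockProd_X_le ℂ _

/-- `waveFunction` as a polynomial. -/
noncomputable def wavePoly (n : ℕ) : MvPolynomial (Fin (2 * n)) ℂ :=
  pfaffianPoly n * ∏ i, X i

theorem eval_wavePoly (z : Fin (2 * n) → ℂ) : eval z (wavePoly n) = waveFunction z := by
  simp only [wavePoly, map_mul, map_prod, eval_X, eval_pfaffianPoly, waveFunction]

theorem wavePoly_isSymmetric : (wavePoly n).IsSymmetric := fun τ =>
  MvPolynomial.funext fun z => by
    rw [eval_rename, eval_wavePoly, eval_wavePoly, waveFunction_comp_perm]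

theorem wavePoly_exponent_bounds {d : Fin (2 * n) →₀ ℕ} (hd : d ∈ (wavePoly n).support)
    (i : Fin (2 * n)) : 1 ≤ d i ∧ d i < 2 * n := by
  have h_monomial : (∏ i, X i : MvPolynomial (Fin (2 * n)) ℂ) =
      monomial (∑ i, Finsupp.single i 1) 1 := (monomial_sum_one _ _).symm
  have h_one : (∑ i, Finsupp.single i 1 : Fin (2 * n) →₀ ℕ) i = 1 := by
    simp [Finsupp.finsetSum_apply, Finsupp.single_apply]
  rw [mem_support_iff, wavePoly, h_monomial, coeff_mul_monomial', ite_ne_right_iff] at hd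
  have h_pos : 1 ≤ d i := h_one ▸ hd.1 i
  have h_deg := degreeOf_le_iff.mp (degreeOf_pfaffianPoly_le i) _
    (mem_support_iff.mpr (left_ne_zero_of_mul hd.2))
  rw [Finsupp.tsub_apply, h_one] at h_deg
  have := i.isLt
  omega

end WavePoly

/-! ### Sums over roots of unity -/

section RootSums

variable {K : Type*} [Field K] {N : ℕ} {ζ : K}

open Classical in
/-- The `N`-th roots of unity other than `1`. -/
noncomputable def nontrivialRoots (K : Type*) [Field K] (N : ℕ) : Finset K :=
  (Polynomial.nthRootsFinset N (1 : K)).erase 1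

theorem mem_nontrivialRoots (hN : 0 < N) {x : K} :
    x ∈ nontrivialRoots K N ↔ x ≠ 1 ∧ x ^ N = 1 := by
  simp only [nontrivialRoots, Finset.mem_erase, Polynomial.mem_nthRootsFinset hN, ne_eq]

theorem sum_range_pow_succ_eq_zero (hN : 0 < N) {x : K} (hx : x ∈ nontrivialRoots K N) :
    ∑ k ∈ Finset.range N, x ^ (k + 1) = 0 := by
  obtain ⟨hx_ne, hx_pow⟩ := (mem_nontrivialRoots hN).mp hx
  have h_geom : ∑ k ∈ Finset.range N, x ^ k = 0 := by
    rw [geom_sum_eq hx_ne, hx_pow, sub_self, zero_div]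
  simp only [pow_succ, ← Finset.sum_mul, h_geom, zero_mul]

open Classical in
theorem sum_nontrivialRoots_pow (hζ : IsPrimitiveRoot ζ N) {k : ℕ} (hk : 0 < k) (hkN : k < N) :
    ∑ x ∈ nontrivialRoots K N, x ^ k = -1 := by
  have hN : 0 < N := hk.trans hkN
  have h_rotate : ζ ^ k * ∑ x ∈ Polynomial.nthRootsFinset N (1 : K), x ^ k =
      ∑ x ∈ Polynomial.nthRootsFinset N (1 : K), x ^ k := by
    have hζ_ne : ζ ≠ 0 := hζ.ne_zero hN.ne'
    rw [Finset.mul_sum]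
    refine Finset.sum_nbij' (ζ * ·) (ζ⁻¹ * ·) ?_ ?_ ?_ ?_ ?_
    · simp +contextual only [Polynomial.mem_nthRootsFinset hN, mul_pow, hζ.pow_eq_one, one_mul,
        implies_true]
    · simp +contextual only [Polynomial.mem_nthRootsFinset hN, mul_pow, inv_pow, hζ.pow_eq_one,
        inv_one, one_mul, implies_true]
    · exact fun x _ => inv_mul_cancel_left₀ hζ_ne x
    · exact fun x _ => mul_inv_cancel_left₀ hζ_ne x
    · exact fun x _ => (mul_pow ζ x k).symm
  have h_all : ∑ x ∈ Polynomial.nthRootsFinset N (1 : K), x ^ k = 0 :=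
    (mul_left_eq_self₀.mp h_rotate).resolve_left (hζ.pow_ne_one_of_pos_of_lt hk.ne' hkN)
  have h_erase := Finset.add_sum_erase (Polynomial.nthRootsFinset N (1 : K)) (· ^ k)
    ((Polynomial.mem_nthRootsFinset hN 1).mpr (one_pow N))
  rw [h_all, one_pow] at h_erase
  exact eq_neg_of_add_eq_zero_right h_erase

theorem eq_of_step_eq_of_sum_eq [CharZero K] {f F : ℕ → K}
    (h_step : ∀ k, k + 1 < N → f k - f (k + 1) = F k - F (k + 1))
    (h_sum : ∑ k ∈ Finset.range N, f k = ∑ k ∈ Finset.range N, F k) {k : ℕ} (hk : k < N) :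
    f k = F k := by
  have h_const : ∀ k < N, f k - F k = f 0 - F 0 := by
    intro k
    induction k with
    | zero => simp
    | succ k ih => exact fun hk => by linear_combination ih (by omega) - h_step k hk
  have h_zero : (N : K) * (f 0 - F 0) = 0 := by
    rw [← sub_eq_zero, ← Finset.sum_sub_distrib,
      Finset.sum_congr rfl fun k hk => h_const k (Finset.mem_range.mp hk), Finset.sum_const,
      Finset.card_range, nsmul_eq_mul] at h_sum
    exact h_sum
  have h_first := (mul_eq_zero.mp h_zero).resolve_left (Nat.cast_ne_zero.mpr (by omega))
  exact sub_eq_zero.mp ((h_const k hk).trans h_first)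

theorem sum_nontrivialRoots_pow_div [CharZero K] (hζ : IsPrimitiveRoot ζ N) {k : ℕ} (hk : k < N) :
    ∑ x ∈ nontrivialRoots K N, x ^ (k + 1) / (1 - x) = (k : K) + 1 - (N + 1) / 2 := by
  have hN : 0 < N := by omega
  refine eq_of_step_eq_of_sum_eq (f := fun k => ∑ x ∈ nontrivialRoots K N, x ^ (k + 1) / (1 - x))
    (F := fun k => (k : K) + 1 - (N + 1) / 2) (fun k hk => ?_) ?_ hk
  · have h_pow := sum_nontrivialRoots_pow hζ (Nat.succ_pos k) hk
    rw [← Finset.sum_sub_distrib]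
    refine (Finset.sum_congr rfl fun x hx => ?_).trans (h_pow.trans (by push_cast; ring))
    have h_ne := sub_ne_zero.mpr ((mem_nontrivialRoots hN).mp hx).1.symm
    field_simp
    ring
  · have h_closed (m : ℕ) : ∑ k ∈ Finset.range m, ((k : K) + 1 - (N + 1) / 2) =
        m * (m - N) / 2 := by
      induction m with
      | zero => simp
      | succ m ih => rw [Finset.sum_range_succ, ih]; push_cast; ring
    rw [Finset.sum_comm, h_closed, sub_self, mul_zero, zero_div]
    refine Finset.sum_eq_zero fun x hx => ?_
    rw [← Finset.sum_div, sum_range_pow_succ_eq_zero hN hx, zero_div]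

theorem sum_nontrivialRoots_pow_div_sq [CharZero K] (hζ : IsPrimitiveRoot ζ N) (hN : 0 < N)
    {k : ℕ} (hk : k ≤ N) :
    ∑ x ∈ nontrivialRoots K N, x ^ (k + 1) / (1 - x) ^ 2 =
      -((N : K) ^ 2 - 1) / 12 - k * (k - N) / 2 := by
  wlog hkN : k < N generalizing k
  · obtain rfl : k = N := by omega
    refine .trans (Finset.sum_congr rfl fun x hx => ?_) ((this hN.le hN).trans (by simp))
    rw [pow_succ, ((mem_nontrivialRoots hN).mp hx).2, one_mul, zero_add, pow_one]
  refine eq_of_step_eq_of_sum_eq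
    (f := fun k => ∑ x ∈ nontrivialRoots K N, x ^ (k + 1) / (1 - x) ^ 2)
    (F := fun k => -((N : K) ^ 2 - 1) / 12 - (k : K) * (k - N) / 2) (fun k hk => ?_) ?_ hkN
  · have h_div := sum_nontrivialRoots_pow_div hζ (Nat.lt_of_succ_lt hk)
    rw [← Finset.sum_sub_distrib]
    refine (Finset.sum_congr rfl fun x hx => ?_).trans (h_div.trans (by push_cast; ring))
    have h_ne := sub_ne_zero.mpr ((mem_nontrivialRoots hN).mp hx).1.symm
    field_simp
    ring
  · have h_closed (m : ℕ) :
        ∑ k ∈ Finset.range m, (-((N : K) ^ 2 - 1) / 12 - (k : K) * (k - N) / 2) =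
          -((m : K) * (m - N) * (2 * m - N - 3)) / 12 := by
      induction m with
      | zero => simp
      | succ m ih => rw [Finset.sum_range_succ, ih]; push_cast; ring
    rw [Finset.sum_comm, h_closed, sub_self, mul_zero, zero_mul, neg_zero, zero_div]
    refine Finset.sum_eq_zero fun x hx => ?_
    rw [← Finset.sum_div, sum_range_pow_succ_eq_zero hN hx, zero_div]

end RootSums

/-! ### Sums over the lattice -/

section Lattice

variable {N : ℕ}

theorem eta_eq_pow (α : Fin N) : eta N α = Complex.exp (2 * Real.pi * Complex.I / N) ^ (α : ℕ) := by
  rw [eta, ← Complex.exp_nat_mul]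
  congr 1
  ring

theorem eta_ne_zero (α : Fin N) : eta N α ≠ 0 := Complex.exp_ne_zero _

theorem isPrimitiveRoot_exp_of_fin (α : Fin N) :
    IsPrimitiveRoot (Complex.exp (2 * Real.pi * Complex.I / N)) N :=
  Complex.isPrimitiveRoot_exp N α.pos.ne'

theorem eta_pow_card (α : Fin N) : eta N α ^ N = 1 := by
  rw [eta_eq_pow, pow_right_comm, (isPrimitiveRoot_exp_of_fin α).pow_eq_one, one_pow]

theorem eta_injective : Function.Injective (eta N) := by
  intro α β h
  rw [eta_eq_pow, eta_eq_pow] at h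
  exact Fin.ext ((isPrimitiveRoot_exp_of_fin α).pow_inj α.2 β.2 h)

theorem exists_eta_eq (α : Fin N) {x : ℂ} (hx : x ^ N = 1) : ∃ β, eta N β = x := by
  have : NeZero N := ⟨α.pos.ne'⟩
  obtain ⟨k, hk, rfl⟩ := (isPrimitiveRoot_exp_of_fin α).eq_pow_of_pow_eq_one hx
  exact ⟨⟨k, hk⟩, eta_eq_pow _⟩

theorem eta_sub_ne_zero {α β : Fin N} (h : β ≠ α) : eta N α - eta N β ≠ 0 :=
  sub_ne_zero.mpr (eta_injective.ne h.symm)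

theorem conj_eta (α : Fin N) : conj (eta N α) = (eta N α)⁻¹ := by
  rw [eta, ← Complex.exp_conj, ← Complex.exp_neg]
  congr 1
  simp [Complex.conj_ofReal, neg_div, map_ofNat]

theorem conj_eta_sub (α β : Fin N) :
    conj (eta N α) - conj (eta N β) = -(eta N α - eta N β) / (eta N α * eta N β) := by
  have h_α := eta_ne_zero α
  have h_β := eta_ne_zero β
  rw [conj_eta, conj_eta]
  field_simp
  ring

theorem sum_erase_div_eta {M : Type*} [AddCommMonoid M] (α : Fin N) (G : ℂ → M) :
    ∑ β ∈ Finset.univ.erase α, G (eta N β / eta N α) = ∑ x ∈ nontrivialRoots ℂ N, G x := by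
  refine Finset.sum_nbij (fun β => eta N β / eta N α) (fun β hβ => ?_) (fun β _ γ _ h => ?_)
    (fun x hx => ?_) fun _ _ => rfl
  · rw [mem_nontrivialRoots α.pos, ne_eq, div_eq_one_iff_eq (eta_ne_zero α), div_pow,
      eta_pow_card, eta_pow_card, div_one]
    exact ⟨eta_injective.ne (Finset.ne_of_mem_erase hβ), rfl⟩
  · exact eta_injective ((div_left_inj' (eta_ne_zero α)).mp h)
  · obtain ⟨hx_ne, hx_pow⟩ := (mem_nontrivialRoots α.pos).mp hx
    obtain ⟨β, hβ⟩ := exists_eta_eq α (x := x * eta N α) (by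
      rw [mul_pow, hx_pow, eta_pow_card, one_mul])
    have h_div : eta N β / eta N α = x := by rw [hβ, mul_div_cancel_right₀ x (eta_ne_zero α)]
    refine ⟨β, ?_, h_div⟩
    rw [Finset.mem_coe, Finset.mem_erase]
    refine ⟨fun h => hx_ne ?_, Finset.mem_univ β⟩
    rw [← h_div, h, div_self (eta_ne_zero α)]

theorem sum_eta_pow {k : ℕ} (hk : 0 < k) (hkN : k < N) : ∑ β, eta N β ^ k = 0 := by
  let α : Fin N := ⟨0, hk.trans hkN⟩
  have h_rest : ∑ β ∈ Finset.univ.erase α, (eta N β / eta N α) ^ k = -1 :=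
    (sum_erase_div_eta α (· ^ k)).trans
      (sum_nontrivialRoots_pow (isPrimitiveRoot_exp_of_fin α) hk hkN)
  simp only [div_pow, ← Finset.sum_div] at h_rest
  rw [div_eq_iff (pow_ne_zero k (eta_ne_zero α))] at h_rest
  rw [← Finset.add_sum_erase Finset.univ _ (Finset.mem_univ α), h_rest]
  ring

theorem sum_eta_pow_div (α : Fin N) {k : ℕ} (hk : 1 ≤ k) (hkN : k ≤ N) :
    ∑ β ∈ Finset.univ.erase α, 1 / (eta N α - eta N β) * eta N β ^ k =
      (eta N α)⁻¹ * (((k : ℂ) - (N + 1) / 2) * eta N α ^ k) := by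
  obtain ⟨k, rfl⟩ := Nat.exists_eq_add_of_le' hk
  have h_roots := (sum_erase_div_eta α fun x => x ^ (k + 1) / (1 - x)).trans
    (sum_nontrivialRoots_pow_div (isPrimitiveRoot_exp_of_fin α) hkN)
  push_cast
  rw [← h_roots, Finset.sum_mul, Finset.mul_sum]
  refine Finset.sum_congr rfl fun β hβ => ?_
  have h_sub := eta_sub_ne_zero (Finset.ne_of_mem_erase hβ)
  have h_α := eta_ne_zero α
  rw [one_sub_div h_α, div_pow]
  field_simp

theorem sum_eta_pow_div_sq (α : Fin N) {k : ℕ} (hk : 1 ≤ k) (hkN : k ≤ N + 1) :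
    ∑ β ∈ Finset.univ.erase α, (1 / (eta N α - eta N β)) ^ 2 * eta N β ^ k =
      (eta N α)⁻¹ ^ 2 *
        ((-((N : ℂ) ^ 2 - 1) / 12 - (k - 1) * (k - 1 - N) / 2) * eta N α ^ k) := by
  obtain ⟨k, rfl⟩ := Nat.exists_eq_add_of_le' hk
  have h_roots := (sum_erase_div_eta α fun x => x ^ (k + 1) / (1 - x) ^ 2).trans
    (sum_nontrivialRoots_pow_div_sq (isPrimitiveRoot_exp_of_fin α) α.pos (by omega))
  push_cast
  rw [add_sub_cancel_right, ← h_roots, Finset.sum_mul, Finset.mul_sum]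
  refine Finset.sum_congr rfl fun β hβ => ?_
  have h_sub := eta_sub_ne_zero (Finset.ne_of_mem_erase hβ)
  have h_α := eta_ne_zero α
  rw [one_sub_div h_α, div_pow, div_pow]
  field_simp

/-- The coefficients `c β`, `β ≠ α`, act on the monomials `z ^ k`, `1 ≤ k < N`, like the
first-order operator `A (z ∂ - κ)` at the site `α`, and their squares like a second-order operator
with leading term `-(A z ∂)² / 2`. -/
structure IsEulerKernel (α : Fin N) (c : Fin N → ℂ) (A κ p q : ℂ) : Prop where
  sum_mul_pow : ∀ k : ℕ, 1 ≤ k → k < N →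
    ∑ β ∈ Finset.univ.erase α, c β * eta N β ^ k = A * (k - κ) * eta N α ^ k
  sum_sq_mul_pow : ∀ k : ℕ, 1 ≤ k → k < N →
    ∑ β ∈ Finset.univ.erase α, c β ^ 2 * eta N β ^ k =
      A ^ 2 * (p + q * k - k ^ 2 / 2) * eta N α ^ k

theorem isEulerKernel_one_div_sub (α : Fin N) :
    ∃ A κ p q, IsEulerKernel α (fun β => 1 / (eta N α - eta N β)) A κ p q := by
  refine ⟨(eta N α)⁻¹, (N + 1) / 2, -((N : ℂ) ^ 2 - 1) / 12 - (N + 1) / 2, (N + 2) / 2,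
    ⟨fun k hk hkN => ?_, fun k hk hkN => ?_⟩⟩
  · rw [sum_eta_pow_div α hk hkN.le]
    ring
  · rw [sum_eta_pow_div_sq α hk (by omega)]
    ring

theorem one_div_conj_eta_sub (α β : Fin N) :
    1 / (conj (eta N α) - conj (eta N β)) = -eta N α * (1 / (eta N α - eta N β) * eta N β) := by
  rw [conj_eta_sub, one_div_div, div_neg]
  ring

theorem isEulerKernel_one_div_conj_sub (α : Fin N) :
    ∃ A κ p q, IsEulerKernel α (fun β => 1 / (conj (eta N α) - conj (eta N β))) A κ p q := by
  have h_α := eta_ne_zero α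
  refine ⟨-eta N α, (N - 1) / 2, -((N : ℂ) ^ 2 - 1) / 12 + (N - 1) / 2, (N - 2) / 2,
    ⟨fun k hk hkN => ?_, fun k hk hkN => ?_⟩⟩
  · simp only [one_div_conj_eta_sub, mul_assoc, ← pow_succ']
    rw [← Finset.mul_sum, sum_eta_pow_div α (by omega) (by omega)]
    push_cast
    field_simp
    ring
  · simp only [one_div_conj_eta_sub, mul_pow, mul_assoc, ← pow_add, add_comm 2 k]
    rw [← Finset.mul_sum, sum_eta_pow_div_sq α (by omega) (by omega)]
    push_cast
    field_simp
    ring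

end Lattice

/-! ### Moments of polynomials -/

section Moments

open MvPolynomial

variable {σ R : Type*} [Fintype σ] [CommRing R] {P : MvPolynomial σ R} {z : σ → R}

/-- The values at `z` of the monomials of `P`, summed with a weight that depends on the exponents.
The weight `e ↦ ∏ i, (e i) ^ k i` gives the value at `z` of `∏ i, (z i ∂ i) ^ k i` applied
to `P`. -/
noncomputable def moment (P : MvPolynomial σ R) (z : σ → R) : ((σ → ℕ) → R) →ₗ[R] R :=
  ∑ d ∈ P.support, (P.coeff d * ∏ i, z i ^ d i) • LinearMap.proj (d : σ → ℕ)

theorem moment_apply (P : MvPolynomial σ R) (z : σ → R) (g : (σ → ℕ) → R) :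
    moment P z g = ∑ d ∈ P.support, P.coeff d * (∏ i, z i ^ d i) * g d := by
  simp only [moment, LinearMap.sum_apply, LinearMap.smul_apply, LinearMap.proj_apply, smul_eq_mul]

theorem moment_one (P : MvPolynomial σ R) (z : σ → R) : moment P z 1 = eval z P := by
  simp only [moment_apply, eval_eq', Pi.one_apply, mul_one]

theorem moment_comp_perm (hP : P.IsSymmetric) {τ : Equiv.Perm σ} (hz : z ∘ τ = z)
    (g : (σ → ℕ) → R) : moment P z (fun e => g (e ∘ τ)) = moment P z g := by
  have h_coeff (τ : Equiv.Perm σ) (d : σ →₀ ℕ) : P.coeff (d.mapDomain τ) = P.coeff d := by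
    conv_lhs => rw [← hP τ]
    exact coeff_rename_mapDomain τ τ.injective P d
  rw [moment_apply, moment_apply]
  refine Finset.sum_nbij' (Finsupp.mapDomain τ.symm) (Finsupp.mapDomain τ)
    (fun d hd => ?_) (fun d hd => ?_) (fun d _ => ?_) (fun d _ => ?_) fun d _ => ?_
  · rwa [mem_support_iff, h_coeff, ← mem_support_iff]
  · rwa [mem_support_iff, h_coeff, ← mem_support_iff]
  · rw [← Finsupp.mapDomain_comp, Equiv.self_comp_symm, Finsupp.mapDomain_id]
  · rw [← Finsupp.mapDomain_comp, Equiv.symm_comp_self, Finsupp.mapDomain_id]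
  · have h_map : ⇑(d.mapDomain τ.symm) = d ∘ τ :=
      funext fun i => Finsupp.mapDomain_equiv_apply d i
    have h_prod : ∏ i, z i ^ d (τ i) = ∏ i, z i ^ d i := by
      rw [← Equiv.prod_comp τ fun i => z i ^ d i]
      exact Finset.prod_congr rfl fun i _ => congrArg (· ^ d (τ i)) (congrFun hz i).symm
    rw [h_coeff, h_map]
    simp only [Function.comp_apply, h_prod]

theorem moment_swap [DecidableEq σ] (hP : P.IsSymmetric) {i j : σ} (hz : z i = z j)
    (g : (σ → ℕ) → R) : moment P z (fun e => g (e ∘ Equiv.swap i j)) = moment P z g :=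
  moment_comp_perm hP (funext (Equiv.apply_swap_eq_self hz)) g

theorem moment_comp_sum_eq_zero [IsDomain R] [Infinite R] [DecidableEq σ] {s : Finset σ} {x : R}
    (hz : ∀ i ∈ s, z i = x) (hP : ∀ t, eval (s.piecewise (fun _ => t) z) P = 0) (g : ℕ → R) :
    moment P z (fun e => g (∑ i ∈ s, e i)) = 0 := by
  have h_split (y : σ → R) (d : σ → ℕ) (t : R) (hs : ∀ i ∈ s, y i = t) (hz : ∀ i ∉ s, y i = z i) :
      ∏ i, y i ^ d i = t ^ (∑ i ∈ s, d i) * ∏ i ∈ sᶜ, z i ^ d i := by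
    rw [← Finset.prod_mul_prod_compl s, ← Finset.prod_pow_eq_pow_sum]
    exact congrArg₂ _ (Finset.prod_congr rfl fun i hi => by rw [hs i hi])
      (Finset.prod_congr rfl fun i hi => by rw [hz i (Finset.mem_compl.mp hi)])
  let Q : Polynomial R := ∑ d ∈ P.support,
    Polynomial.monomial (∑ i ∈ s, d i) (P.coeff d * ∏ i ∈ sᶜ, z i ^ d i)
  have hQ : Q = 0 := Polynomial.funext fun t => by
    rw [Polynomial.eval_zero, ← hP t, eval_eq', Polynomial.eval_finsetSum]
    refine Finset.sum_congr rfl fun d _ => ?_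
    rw [h_split _ d t (fun i hi => Finset.piecewise_eq_of_mem _ _ _ hi)
      (fun i hi => Finset.piecewise_eq_of_notMem _ _ _ hi), Polynomial.eval_monomial]
    ring
  let T : Polynomial R →ₗ[R] R := Polynomial.lsum fun k => (x ^ k * g k) • LinearMap.id
  have hT (k : ℕ) (a : R) : T (Polynomial.monomial k a) = x ^ k * g k * a := by
    simp only [T, Polynomial.lsum_apply]
    exact Polynomial.sum_monomial_index a _ (map_zero _)
  rw [moment_apply, ← map_zero T, ← hQ, map_sum]
  refine Finset.sum_congr rfl fun d _ => ?_
  rw [hT, h_split z d x hz fun _ _ => rfl]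
  ring

theorem sum_mul_moment_update [DecidableEq σ] {ι : Type*} {s : Finset ι} {c u : ι → R} {i : σ}
    {f : ℕ → R} (hf : ∀ d ∈ P.support, ∑ β ∈ s, c β * u β ^ d i = f (d i) * z i ^ d i)
    (g : (σ → ℕ) → R) :
    ∑ β ∈ s, c β * moment P (Function.update z i (u β)) g =
      moment P z fun e => f (e i) * g e := by
  have h_split (v : R) (d : σ → ℕ) : ∏ k, Function.update z i v k ^ d k =
      v ^ d i * ∏ k ∈ Finset.univ.erase i, z k ^ d k := by
    rw [← Finset.mul_prod_erase Finset.univ _ (Finset.mem_univ i), Function.update_self]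
    exact congrArg _ (Finset.prod_congr rfl fun k hk => by
      rw [Function.update_of_ne (Finset.ne_of_mem_erase hk)])
  simp only [moment_apply, h_split, Finset.mul_sum]
  rw [Finset.sum_comm]
  refine Finset.sum_congr rfl fun d hd => ?_
  rw [← Finset.mul_prod_erase Finset.univ _ (Finset.mem_univ i)]
  calc ∑ β ∈ s, c β * (P.coeff d * (u β ^ d i * ∏ k ∈ Finset.univ.erase i, z k ^ d k) * g d)
      = (∑ β ∈ s, c β * u β ^ d i) *
          (P.coeff d * (∏ k ∈ Finset.univ.erase i, z k ^ d k) * g d) := by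
        rw [Finset.sum_mul]
        exact Finset.sum_congr rfl fun β _ => by ring
    _ = _ := by rw [hf d hd]; ring

section TripleCoincidence

variable [IsDomain R] [CharZero R] {i j k : σ} (hij : i ≠ j) (hik : i ≠ k) (hjk : j ≠ k)
  (h_ij : z i = z j) (h_ik : z i = z k) (hP : P.IsSymmetric)
  (h_zero : ∀ y, y i = y j → y i = y k → eval y P = 0)

include hij hik hjk h_ij h_ik h_zero

theorem moment_comp_add_add_eq_zero (g : ℕ → R) :
    moment P z (fun e => g (e i + e j + e k)) = 0 := by
  classical
  have h_sum (e : σ → ℕ) : ∑ l ∈ {i, j, k}, e l = e i + e j + e k := by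
    rw [Finset.sum_insert (by simp [hij, hik]), Finset.sum_pair hjk, add_assoc]
  rw [← moment_comp_sum_eq_zero (P := P) (s := {i, j, k}) (x := z i) (z := z) ?_ ?_ g]
  · simp only [h_sum]
  · simp [← h_ij, ← h_ik]
  · exact fun t => h_zero _ (by simp) (by simp)

include hP

theorem moment_exponent_eq_zero : moment P z (fun e => (e i : R)) = 0 := by
  classical
  have h_sum := moment_comp_add_add_eq_zero hij hik hjk h_ij h_ik h_zero fun m => (m : R)
  have h_expand : (fun e : σ → ℕ => ((e i + e j + e k : ℕ) : R)) =
      (fun e => (e i : R)) + (fun e => (e j : R)) + fun e => (e k : R) := by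
    ext e
    simp
  have h_j := moment_swap hP h_ij fun e => (e i : R)
  have h_k := moment_swap hP h_ik fun e => (e i : R)
  simp only [Function.comp_apply, Equiv.swap_apply_left] at h_j h_k
  rw [h_expand, map_add, map_add, h_j, h_k] at h_sum
  refine (mul_eq_zero.mp (?_ : (3 : R) * _ = 0)).resolve_left (OfNat.ofNat_ne_zero 3)
  linear_combination h_sum

theorem moment_exponent_sq_add :
    moment P z (fun e => (e i : R) ^ 2) + 2 * moment P z (fun e => (e i : R) * e j) = 0 := by
  classical
  have h_sum := moment_comp_add_add_eq_zero hij hik hjk h_ij h_ik h_zero fun m => (m : R) ^ 2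
  have h_expand : (fun e : σ → ℕ => ((e i + e j + e k : ℕ) : R) ^ 2) =
      (fun e => (e i : R) ^ 2) + (fun e => (e j : R) ^ 2) + (fun e => (e k : R) ^ 2) +
        (2 : R) • ((fun e => (e i : R) * e j) + (fun e => (e i : R) * e k) +
          fun e => (e j : R) * e k) := by
    ext e
    simp only [Pi.add_apply, Pi.smul_apply, smul_eq_mul]
    push_cast
    ring
  have h_jk : z j = z k := h_ij.symm.trans h_ik
  have h_j := moment_swap hP h_ij fun e => (e i : R) ^ 2
  have h_k := moment_swap hP h_ik fun e => (e i : R) ^ 2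
  have h_ik' := moment_swap hP h_jk fun e => (e i : R) * e j
  have h_jk' := moment_swap hP h_ij fun e => (e i : R) * e k
  simp only [Function.comp_apply, Equiv.swap_apply_left, Equiv.swap_apply_of_ne_of_ne hij hik,
    Equiv.swap_apply_of_ne_of_ne hik.symm hjk.symm] at h_j h_k h_ik' h_jk'
  simp only [h_expand, map_add, map_smul, smul_eq_mul, h_j, h_k, h_jk', h_ik'] at h_sum
  refine (mul_eq_zero.mp (?_ : (3 : R) * _ = 0)).resolve_left (OfNat.ofNat_ne_zero 3)
  linear_combination h_sum

end TripleCoincidence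

end Moments

/-! ### Lattice polynomials -/

section LatticePoly

variable {N M : ℕ} {P : MvPolynomial (Fin M) ℂ}

/-- Symmetric polynomials with all exponents between `1` and `N - 1` that vanish if three
coordinates coincide. -/
structure IsLatticePoly (N : ℕ) (P : MvPolynomial (Fin M) ℂ) : Prop where
  symm : P.IsSymmetric
  exponent : ∀ d ∈ P.support, ∀ i, 1 ≤ d i ∧ d i < N
  triple : ∀ (z : Fin M → ℂ) (i j k : Fin M), i ≠ j → i ≠ k → j ≠ k → z i = z j → z i = z k →
    MvPolynomial.eval z P = 0

theorem IsLatticePoly.sum_eval_update (hP : IsLatticePoly N P) (z : Fin M → ℂ) (i : Fin M) :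
    ∑ β, MvPolynomial.eval (Function.update z i (eta N β)) P = 0 := by
  have h_update := sum_mul_moment_update (P := P) (z := z) (s := Finset.univ) (c := fun _ => 1)
    (u := eta N) (i := i) (f := 0) (fun d hd => ?_) 1
  · simp only [moment_one, one_mul, Pi.zero_apply, zero_mul] at h_update
    rw [h_update]
    exact map_zero (moment P z)
  · simp only [one_mul, Pi.zero_apply, zero_mul]
    exact sum_eta_pow (hP.exponent d hd i).1 (hP.exponent d hd i).2

variable {α : Fin N} {c : Fin N → ℂ} {A κ p q : ℂ} {z : Fin M → ℂ} {i j k : Fin M}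

theorem IsLatticePoly.sum_mul_moment_update (hP : IsLatticePoly N P)
    (hc : IsEulerKernel α c A κ p q) (hz : z i = eta N α) (g : (Fin M → ℕ) → ℂ) :
    ∑ β ∈ Finset.univ.erase α, c β * moment P (Function.update z i (eta N β)) g =
      moment P z fun e => A * (e i - κ) * g e :=
  PfaffianChain.sum_mul_moment_update (f := fun m => A * (m - κ)) (fun d hd => by
    rw [hz, hc.sum_mul_pow _ (hP.exponent d hd i).1 (hP.exponent d hd i).2]) g

theorem IsLatticePoly.sum_sq_mul_moment_update (hP : IsLatticePoly N P)
    (hc : IsEulerKernel α c A κ p q) (hz : z i = eta N α) (g : (Fin M → ℕ) → ℂ) :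
    ∑ β ∈ Finset.univ.erase α, c β ^ 2 * moment P (Function.update z i (eta N β)) g =
      moment P z fun e => A ^ 2 * (p + q * e i - (e i : ℂ) ^ 2 / 2) * g e :=
  PfaffianChain.sum_mul_moment_update (f := fun m => A ^ 2 * (p + q * m - (m : ℂ) ^ 2 / 2))
    (fun d hd => by
      rw [hz, hc.sum_sq_mul_pow _ (hP.exponent d hd i).1 (hP.exponent d hd i).2]) g

variable (hP : IsLatticePoly N P) (hc : IsEulerKernel α c A κ p q) (hij : i ≠ j) (hik : i ≠ k)
  (hjk : j ≠ k) (hi : z i = eta N α) (hj : z j = eta N α) (hk : z k = eta N α)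

include hP hc hij hik hjk hi hj hk

theorem IsLatticePoly.sum_mul_eval_update :
    ∑ β ∈ Finset.univ.erase α,
      c β * MvPolynomial.eval (Function.update z i (eta N β)) P = 0 := by
  have h_first := moment_exponent_eq_zero hij hik hjk (hi.trans hj.symm) (hi.trans hk.symm)
    hP.symm (hP.triple · i j k hij hik hjk)
  have h_value : moment P z 1 = 0 := by
    rw [moment_one, hP.triple z i j k hij hik hjk (hi.trans hj.symm) (hi.trans hk.symm)]
  have h_expand : (fun e : Fin M → ℕ => A * (e i - κ) * (1 : (Fin M → ℕ) → ℂ) e) =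
      A • (fun e => (e i : ℂ)) - (A * κ) • (1 : (Fin M → ℕ) → ℂ) := by
    ext e
    simp only [Pi.sub_apply, Pi.smul_apply, Pi.one_apply, smul_eq_mul]
    ring
  simp only [← moment_one]
  rw [hP.sum_mul_moment_update hc hi, h_expand, map_sub, map_smul, map_smul, h_first, h_value,
    smul_zero, smul_zero, sub_zero]

theorem IsLatticePoly.sum_mul_eval_update_update :
    ∑ β ∈ Finset.univ.erase α, ∑ γ ∈ Finset.univ.erase α, c β * c γ *
        MvPolynomial.eval (Function.update (Function.update z i (eta N β)) j (eta N γ)) P =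
      ∑ β ∈ Finset.univ.erase α,
        c β ^ 2 * MvPolynomial.eval (Function.update z i (eta N β)) P := by
  have h_ij := hi.trans hj.symm
  have h_ik := hi.trans hk.symm
  have h_i := moment_exponent_eq_zero hij hik hjk h_ij h_ik hP.symm (hP.triple · i j k hij hik hjk)
  have h_j := moment_exponent_eq_zero hij.symm hjk hik h_ij.symm (hj.trans hk.symm) hP.symm
    (hP.triple · j i k hij.symm hjk hik)
  have h_sq := moment_exponent_sq_add hij hik hjk h_ij h_ik hP.symm
    (hP.triple · i j k hij hik hjk)
  have h_value : moment P z 1 = 0 := by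
    rw [moment_one, hP.triple z i j k hij hik hjk h_ij h_ik]
  have h_double : (fun e : Fin M → ℕ =>
      A * (e i - κ) * (A * (e j - κ) * (1 : (Fin M → ℕ) → ℂ) e)) =
      A ^ 2 • ((fun e => (e i : ℂ) * e j) - κ • (fun e => (e i : ℂ)) - κ • (fun e => (e j : ℂ)) +
        κ ^ 2 • (1 : (Fin M → ℕ) → ℂ)) := by
    ext e
    simp only [Pi.add_apply, Pi.sub_apply, Pi.smul_apply, Pi.one_apply, smul_eq_mul]
    ring
  have h_single : (fun e : Fin M → ℕ =>
      A ^ 2 * (p + q * e i - (e i : ℂ) ^ 2 / 2) * (1 : (Fin M → ℕ) → ℂ) e) =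
      A ^ 2 • (p • (1 : (Fin M → ℕ) → ℂ) + q • (fun e => (e i : ℂ)) -
        (1 / 2 : ℂ) • fun e => (e i : ℂ) ^ 2) := by
    ext e
    simp only [Pi.add_apply, Pi.sub_apply, Pi.smul_apply, Pi.one_apply, smul_eq_mul]
    ring
  simp only [← moment_one, mul_assoc, ← Finset.mul_sum]
  rw [hP.sum_sq_mul_moment_update hc hi, h_single]
  simp only [fun β => hP.sum_mul_moment_update hc (z := Function.update z i (eta N β)) (i := j)
    ((Function.update_of_ne hij.symm _ z).trans hj), hP.sum_mul_moment_update hc hi]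
  rw [h_double]
  simp only [map_smul, map_sub, map_add, h_i, h_j, h_value, smul_eq_mul]
  linear_combination A ^ 2 / 2 * h_sq

end LatticePoly

/-! ### Annihilation operators -/

section Annihilation

variable {N M : ℕ}

/-- The wave function on the lattice given by the values of a polynomial. -/
noncomputable def latticeFn (N : ℕ) (P : MvPolynomial (Fin M) ℂ) (a : Fin M → Fin N) : ℂ :=
  MvPolynomial.eval (eta N ∘ a) P

theorem ket_eq_zero {ψ : (Fin M → Fin N) → ℂ} (h : ∀ a, ψ a = 0) : ket ψ = 0 := by
  rw [funext h, ← Pi.zero_def, map_zero]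

/-- The coordinates of three particles at the site `α` and of further ones at the sites `b`. -/
def threeAt (α : Fin N) (b : Fin M → Fin N) : Fin (M + 3) → Fin N :=
  Fin.cons α (Fin.cons α (Fin.cons α b : Fin (M + 1) → Fin N) : Fin (M + 2) → Fin N)

theorem Sm_mul_Sm_mul_Sm_mulVec_ket {ψ : (Fin (M + 3) → Fin N) → ℂ} (h : IsAdmissible ψ)
    (α β γ : Fin N) :
    (Sm α * Sm β * Sm γ) *ᵥ ket ψ = ((M + 3 : ℂ) * (M + 2) * (M + 1)) •
      ket fun b => ψ (Function.update (Function.update (threeAt α b) 0 γ) 1 β) := by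
  have h_cons (b : Fin M → Fin N) : Function.update (Function.update (threeAt α b) 0 γ) 1 β =
      Fin.cons γ (Fin.cons β (Fin.cons α b : Fin (M + 1) → Fin N) : Fin (M + 2) → Fin N) := by
    rw [threeAt, Fin.update_cons_zero, ← Fin.succ_zero_eq_one, ← Fin.cons_update,
      Fin.update_cons_zero]
  simp only [h_cons]
  rw [← mulVec_mulVec, Sm_mulVec_ket h, ← mulVec_mulVec, mulVec_smul, Sm_mulVec_ket (h.cons γ),
    smul_smul, mulVec_smul, Sm_mulVec_ket ((h.cons γ).cons β), smul_smul]
  congr 1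
  push_cast
  ring

theorem Sm_sq_mul_Sm_mulVec_ket {ψ : (Fin (M + 3) → Fin N) → ℂ} (h : IsAdmissible ψ)
    (α β : Fin N) :
    (Sm α ^ 2 * Sm β) *ᵥ ket ψ = ((M + 3 : ℂ) * (M + 2) * (M + 1)) •
      ket fun b => ψ (Function.update (threeAt α b) 0 β) := by
  have h_self (b : Fin M → Fin N) : Function.update (Function.update (threeAt α b) 0 β) 1 α =
      Function.update (threeAt α b) 0 β :=
    Function.update_eq_self 1 (Function.update (threeAt α b) 0 β)
  simp only [sq, Sm_mul_Sm_mul_Sm_mulVec_ket h, h_self]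

theorem Sm_mul_Sm_mul_Sm_mulVec_ket_of_lt {ψ : (Fin M → Fin N) → ℂ} (hM : M < 3)
    (h : IsAdmissible ψ) (α β γ : Fin N) : (Sm α * Sm β * Sm γ) *ᵥ ket ψ = 0 := by
  simp only [← mulVec_mulVec]
  match M, hM, ψ, h with
  | 0, _, ψ, _ => simp only [Sm_mulVec_ket_zero, mulVec_zero]
  | 1, _, ψ, h => simp only [Sm_mulVec_ket h, mulVec_smul, Sm_mulVec_ket_zero, smul_zero,
      mulVec_zero]
  | 2, _, ψ, h => simp only [Sm_mulVec_ket h, Sm_mulVec_ket (h.cons γ), mulVec_smul,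
      Sm_mulVec_ket_zero, smul_zero]

namespace IsLatticePoly

theorem isAdmissible {P : MvPolynomial (Fin M) ℂ} (hP : IsLatticePoly N P) :
    IsAdmissible (latticeFn N P) where
  symm σ a := by
    rw [latticeFn, latticeFn]
    conv_rhs => rw [← hP.symm σ, MvPolynomial.eval_rename]
    rfl
  triple a α h := by
    obtain ⟨i, hi, j, hj, k, hk, hij, hik, hjk⟩ := Finset.two_lt_card.mp h
    simp only [Finset.mem_filter, Finset.mem_univ, true_and] at hi hj hk
    exact hP.triple _ i j k hij hik hjk (congrArg (eta N) (hi.trans hj.symm))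
      (congrArg (eta N) (hi.trans hk.symm))

variable {P : MvPolynomial (Fin M) ℂ} {α : Fin N} {c : Fin N → ℂ} {A κ p q : ℂ}

theorem sum_smul_mulVec_ket (hP : IsLatticePoly N P) (hc : IsEulerKernel α c A κ p q) :
    (∑ β ∈ Finset.univ.erase α, c β • (Sm α ^ 2 * Sm β)) *ᵥ ket (latticeFn N P) = 0 := by
  simp only [sum_mulVec, smul_mulVec]
  rcases lt_or_ge M 3 with hM | hM
  · simp only [sq, Sm_mul_Sm_mul_Sm_mulVec_ket_of_lt hM hP.isAdmissible, smul_zero,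
      Finset.sum_const_zero]
  obtain ⟨K, rfl⟩ := Nat.exists_eq_add_of_le' hM
  simp only [Sm_sq_mul_Sm_mulVec_ket hP.isAdmissible, smul_comm (c _), ← Finset.smul_sum,
    ← map_smul, ← map_sum]
  refine ket_eq_zero fun b => mul_eq_zero_of_right _ ?_
  simp only [Finset.sum_apply, Pi.smul_apply, smul_eq_mul, latticeFn, Function.comp_update]
  exact hP.sum_mul_eval_update (i := 0) (j := 1) (k := 2) hc nofun nofun nofun rfl rfl rfl

theorem sum_sum_smul_sub_mulVec_ket (hP : IsLatticePoly N P) (hc : IsEulerKernel α c A κ p q) :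
    ((∑ β ∈ Finset.univ.erase α, ∑ γ ∈ Finset.univ.erase α,
        (c β * c γ) • (Sm α * Sm β * Sm γ)) -
      ∑ β ∈ Finset.univ.erase α, c β ^ 2 • (Sm α ^ 2 * Sm β)) *ᵥ ket (latticeFn N P) = 0 := by
  simp only [sub_mulVec, sum_mulVec, smul_mulVec]
  rcases lt_or_ge M 3 with hM | hM
  · simp only [sq, Sm_mul_Sm_mul_Sm_mulVec_ket_of_lt hM hP.isAdmissible, smul_zero,
      Finset.sum_const_zero, sub_zero]
  obtain ⟨K, rfl⟩ := Nat.exists_eq_add_of_le' hM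
  simp only [Sm_sq_mul_Sm_mulVec_ket hP.isAdmissible, Sm_mul_Sm_mul_Sm_mulVec_ket hP.isAdmissible,
    smul_comm (c _ ^ 2), smul_comm (c _ * c _), ← Finset.smul_sum, ← smul_sub, ← map_smul,
    ← map_sum, ← map_sub]
  refine ket_eq_zero fun b => mul_eq_zero_of_right _ ?_
  simp only [Pi.sub_apply, Finset.sum_apply, Pi.smul_apply, smul_eq_mul, latticeFn,
    Function.comp_update]
  rw [sub_eq_zero, Finset.sum_comm]
  simp only [mul_comm (c _) (c _)]
  exact hP.sum_mul_eval_update_update (i := 0) (j := 1) (k := 2) hc nofun nofun nofun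
    rfl rfl rfl

end IsLatticePoly

theorem isLatticePoly_wavePoly (n : ℕ) : IsLatticePoly (2 * n) (wavePoly n) where
  symm := wavePoly_isSymmetric
  exponent _ hd i := wavePoly_exponent_bounds hd i
  triple z i j k hij hik hjk h_ij h_ik := by
    rw [eval_wavePoly, waveFunction_eq_zero hij hik hjk h_ij h_ik]

theorem psi0_eq_ket (n : ℕ) : psi0 n = ket (latticeFn (2 * n) (wavePoly n)) := by
  simp only [psi0, ket_apply, latticeFn, eval_wavePoly]
  rfl

theorem psi0_ne_zero (n : ℕ) : psi0 n ≠ 0 := by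
  intro h
  rw [psi0_eq_ket] at h
  have h_site := (isLatticePoly_wavePoly n).isAdmissible.eq_zero_of_ket_eq_zero h
    fun i => (block i).castLE (by omega)
  rw [latticeFn, eval_wavePoly] at h_site
  exact waveFunction_comp_block_ne_zero
    (eta_injective.comp (Fin.castLE_injective (by omega))) (fun k => eta_ne_zero _) h_site

theorem Omega_mulVec_psi0 (n : ℕ) (α : Fin (2 * n)) : Omega (2 * n) α *ᵥ psi0 n = 0 := by
  obtain ⟨A, κ, p, q, hc⟩ := isEulerKernel_one_div_sub α
  rw [psi0_eq_ket]
  exact (isLatticePoly_wavePoly n).sum_smul_mulVec_ket hc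

theorem OmegaBar_mulVec_psi0 (n : ℕ) (α : Fin (2 * n)) : OmegaBar (2 * n) α *ᵥ psi0 n = 0 := by
  obtain ⟨A, κ, p, q, hc⟩ := isEulerKernel_one_div_conj_sub α
  rw [psi0_eq_ket]
  exact (isLatticePoly_wavePoly n).sum_smul_mulVec_ket hc

theorem Xi_mulVec_psi0 (n : ℕ) (α : Fin (2 * n)) : Xi (2 * n) α *ᵥ psi0 n = 0 := by
  obtain ⟨A, κ, p, q, hc⟩ := isEulerKernel_one_div_sub α
  simp only [psi0_eq_ket, Xi, ← one_div_mul_one_div, ← _root_.one_div_pow]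
  exact (isLatticePoly_wavePoly n).sum_sum_smul_sub_mulVec_ket hc

theorem XiBar_mulVec_psi0 (n : ℕ) (α : Fin (2 * n)) : XiBar (2 * n) α *ᵥ psi0 n = 0 := by
  obtain ⟨A, κ, p, q, hc⟩ := isEulerKernel_one_div_conj_sub α
  simp only [psi0_eq_ket, XiBar, ← one_div_mul_one_div, ← _root_.one_div_pow]
  exact (isLatticePoly_wavePoly n).sum_sum_smul_sub_mulVec_ket hc

end Annihilation

/-! ### Singlets -/

section Singlet

variable {N : ℕ}

theorem lie_sum_smul_site (s : Finset (Fin N)) (c d : Fin N → ℂ) (A B : Matrix (Fin 3) (Fin 3) ℂ) :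
    ⁅∑ α ∈ s, c α • site α A, ∑ α ∈ s, d α • site α B⁆ =
      ∑ α ∈ s, (c α * d α) • site α ⁅A, B⁆ := by
  rw [Ring.lie_def, Finset.sum_mul_sum, Finset.sum_mul_sum, Finset.sum_comm (f := fun i j =>
    d i • site i B * c j • site j A), ← Finset.sum_sub_distrib]
  refine Finset.sum_congr rfl fun α hα => ?_
  rw [← Finset.sum_sub_distrib, Finset.sum_eq_single_of_mem α hα fun β _ hβ => ?_]
  · rw [smul_mul_smul_comm, smul_mul_smul_comm, mul_comm (d α), ← smul_sub, Ring.lie_def, site_sub,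
      site_mul, site_mul]
  · rw [smul_mul_smul_comm, smul_mul_smul_comm, mul_comm (d β), (site_commute hβ.symm A B).eq,
      sub_self]

theorem lie_sp_sm : ⁅sp, sm⁆ = (2 : ℂ) • sz := by
  have h := sqrt_two_mul_self
  ext i j
  fin_cases i <;> fin_cases j <;>
    simp [Ring.lie_def, sp, sm, sz, h]

theorem conjTranspose_sp : spᴴ = sm := by
  ext i j
  fin_cases i <;> fin_cases j <;> simp [sp, sm]

open scoped ComplexOrder in
theorem sum_Sp_mulVec_eq_zero {ψ : State N} (hm : (∑ α, Sm α) *ᵥ ψ = 0)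
    (hz : (∑ α, Sz α) *ᵥ ψ = 0) : (∑ α, Sp α) *ᵥ ψ = 0 := by
  have h_lie : ⁅∑ α : Fin N, Sp α, ∑ α : Fin N, Sm α⁆ = (2 : ℂ) • ∑ α, Sz α := by
    simpa only [one_smul, mul_one, lie_sp_sm, site_smul, ← Finset.smul_sum, Sp, Sm, Sz] using
      lie_sum_smul_site (N := N) Finset.univ (fun _ => 1) (fun _ => 1) sp sm
  have h_adjoint : (∑ α : Fin N, Sp α)ᴴ = ∑ α, Sm α := by
    simp only [Sp, Sm, conjTranspose_sum, site_conjTranspose, conjTranspose_sp]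
  have h_norm : (∑ α : Fin N, Sm α) *ᵥ ((∑ α, Sp α) *ᵥ ψ) = 0 := by
    have h := congrArg (fun A : Op N => A *ᵥ ψ) h_lie
    simp only [Ring.lie_def, sub_mulVec, ← mulVec_mulVec, smul_mulVec, hm, hz, mulVec_zero,
      smul_zero, zero_sub, neg_eq_zero] at h
    exact h
  rw [← dotProduct_star_self_eq_zero, star_mulVec, h_adjoint, ← dotProduct_mulVec, h_norm,
    dotProduct_zero]

/-- The spin-one matrices `Sˣ`, `Sʸ`, `Sᶻ`, indexed by the Cartesian directions. -/
noncomputable def spin : Fin 3 → Matrix (Fin 3) (Fin 3) ℂ := ![sx, sy, sz]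

/-- Total spin zero: each component of the total spin annihilates the state. -/
def IsSinglet (ψ : State N) : Prop :=
  ∀ a, (∑ α, site α (spin a)) *ᵥ ψ = 0

theorem isSinglet_of_sum_Sm_of_sum_Sz {ψ : State N} (hm : (∑ α, Sm α) *ᵥ ψ = 0)
    (hz : (∑ α, Sz α) *ᵥ ψ = 0) : IsSinglet ψ := by
  have hp := sum_Sp_mulVec_eq_zero hm hz
  have hx : ∑ α : Fin N, site α sx = (1 / 2 : ℂ) • (∑ α, Sp α + ∑ α, Sm α) := by
    simp only [sx, site_smul, site_add, ← Finset.smul_sum, Finset.sum_add_distrib, Sp, Sm]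
  have hy : ∑ α : Fin N, site α sy =
      (1 / (2 * Complex.I) : ℂ) • (∑ α, Sp α - ∑ α, Sm α) := by
    simp only [sy, site_smul, site_sub, ← Finset.smul_sum, Finset.sum_sub_distrib, Sp, Sm]
  rw [IsSinglet, Fin.forall_fin_succ, Fin.forall_fin_two]
  refine ⟨?_, ?_, hz⟩
  · rw [spin, cons_val_zero, hx, smul_mulVec, add_mulVec, hp, hm, add_zero, smul_zero]
  · rw [spin, cons_val_succ, cons_val_zero, hy, smul_mulVec, sub_mulVec, hp, hm, sub_zero,
      smul_zero]

theorem IsLatticePoly.sum_Sm_mulVec_ket {M : ℕ} {P : MvPolynomial (Fin M) ℂ}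
    (hP : IsLatticePoly N P) : (∑ α, Sm α) *ᵥ ket (latticeFn N P) = 0 := by
  rw [sum_mulVec]
  match M, P, hP with
  | 0, P, _ => simp only [Sm_mulVec_ket_zero, Finset.sum_const_zero]
  | M + 1, P, hP =>
    simp only [Sm_mulVec_ket hP.isAdmissible, ← Finset.smul_sum, ← map_sum]
    rw [ket_eq_zero fun b => ?_, smul_zero]
    simpa only [Finset.sum_apply, latticeFn, Fin.comp_cons, Fin.update_cons_zero] using
      hP.sum_eval_update (Fin.cons 0 (eta N ∘ b)) 0

theorem isSinglet_psi0 (n : ℕ) : IsSinglet (psi0 n) := by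
  rw [psi0_eq_ket]
  refine isSinglet_of_sum_Sm_of_sum_Sz (isLatticePoly_wavePoly n).sum_Sm_mulVec_ket ?_
  rw [sum_Sz_mulVec_ket, sub_self, zero_smul]

end Singlet

/-! ### Vector operators -/

section Vector

variable {V : Type*} [AddCommGroup V] [Module ℂ V]

/-- The relation `𝐊 × 𝐋 = i 𝐌` between the Cartesian components of three operator-valued vectors,
including the vanishing of `[K_a, L_a]`. Directions are counted cyclically in `Fin 3`. -/
structure IsCrossCommutator {R : Type*} [Ring R] [Algebra ℂ R] (K L M : Fin 3 → R) : Prop where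
  lie_self : ∀ a, ⁅K a, L a⁆ = 0
  lie_add_one : ∀ a, ⁅K a, L (a + 1)⁆ = Complex.I • M (a + 2)
  lie_add_two : ∀ a, ⁅K a, L (a + 2)⁆ = -Complex.I • M (a + 1)

/-- The vectors `φ_a` transform under the angular momentum `𝐉` as the Cartesian components of a
vector, i.e. they span a copy of the spin-one representation. -/
structure IsVectorUnder (J : Fin 3 → Module.End ℂ V) (φ : Fin 3 → V) : Prop where
  apply_self : ∀ a, J a (φ a) = 0
  apply_add_one : ∀ a, J a (φ (a + 1)) = Complex.I • φ (a + 2)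
  apply_add_two : ∀ a, J a (φ (a + 2)) = -Complex.I • φ (a + 1)

/-- The spin-two part of the tensor `K_a φ_b`, which is its traceless symmetric part, vanishes. -/
structure HasNoQuintet (K : Fin 3 → Module.End ℂ V) (φ : Fin 3 → V) : Prop where
  offdiag : ∀ {a b}, a ≠ b → K a (φ b) = -K b (φ a)
  diag : ∀ a b, K a (φ a) = K b (φ b)

/-- The vector `i 𝐊 × φ`: how `𝐒 · 𝐊` acts on the Cartesian components of a spin one. -/
def crossAct (K : Fin 3 → Module.End ℂ V) (φ : Fin 3 → V) (a : Fin 3) : V :=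
  Complex.I • (K (a + 1) (φ (a + 2)) - K (a + 2) (φ (a + 1)))

section IsCrossCommutator

variable {K L M : Fin 3 → Module.End ℂ V} (h : IsCrossCommutator K L M) (a : Fin 3) (v : V)
include h

theorem IsCrossCommutator.apply_apply_self : K a (L a v) = L a (K a v) :=
  sub_eq_zero.mp (LinearMap.congr_fun (h.lie_self a) v)

theorem IsCrossCommutator.apply_apply_add_one :
    K a (L (a + 1) v) = L (a + 1) (K a v) + Complex.I • M (a + 2) v :=
  sub_eq_iff_eq_add'.mp (LinearMap.congr_fun (h.lie_add_one a) v)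

theorem IsCrossCommutator.apply_apply_add_two :
    K a (L (a + 2) v) = L (a + 2) (K a v) + -Complex.I • M (a + 1) v :=
  sub_eq_iff_eq_add'.mp (LinearMap.congr_fun (h.lie_add_two a) v)

end IsCrossCommutator

theorem sum_eq_add_cyclic {G : Type*} [AddCommGroup G] (f : Fin 3 → G) (a : Fin 3) :
    ∑ b, f b = f a + f (a + 1) + f (a + 2) := by
  rw [Fin.sum_univ_three]
  fin_cases a <;> simp <;> abel

variable {K L M : Fin 3 → Module.End ℂ V} {φ : Fin 3 → V}

theorem HasNoQuintet.two_smul_apply_apply (hK : HasNoQuintet K φ) (hL : HasNoQuintet L φ)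
    (h : IsCrossCommutator K L M) (a : Fin 3) :
    (2 : ℂ) • K a (L a (φ a)) =
      -(K (a + 1) (L (a + 1) (φ a)) + K (a + 2) (L (a + 2) (φ a))) - crossAct M φ a := by
  have h₁ : a ≠ a + 1 := by simp
  have h₂ : a ≠ a + 2 := by simp
  have via_add_one : K a (L a (φ a)) =
      -K (a + 1) (L (a + 1) (φ a)) + Complex.I • M (a + 2) (φ (a + 1)) := by
    rw [hL.diag a (a + 1), h.apply_apply_add_one, hK.offdiag h₁, map_neg, h.apply_apply_self]
  have via_add_two : K a (L a (φ a)) =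
      -K (a + 2) (L (a + 2) (φ a)) + -Complex.I • M (a + 1) (φ (a + 2)) := by
    rw [hL.diag a (a + 2), h.apply_apply_add_two, hK.offdiag h₂, map_neg, h.apply_apply_self]
  rw [two_smul]
  nth_rw 1 [via_add_one]
  rw [via_add_two, crossAct]
  module

theorem crossAct_crossAct (h : IsCrossCommutator K L M) (hK : HasNoQuintet K φ)
    (hL : HasNoQuintet L φ) (a : Fin 3) :
    crossAct K (crossAct L φ) a =
      (4 : ℂ) • ∑ b, K b (L b (φ a)) + (2 : ℂ) • crossAct M φ a := by
  have cross_add_one : crossAct L φ (a + 1) = (2 * Complex.I) • L (a + 2) (φ a) := by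
    rw [crossAct, add_assoc, add_assoc, show (1 + 2 : Fin 3) = 0 from rfl, add_zero,
      show (1 + 1 : Fin 3) = 2 from rfl, hL.offdiag (show a ≠ a + 2 by simp)]
    module
  have cross_add_two : crossAct L φ (a + 2) = -(2 * Complex.I) • L (a + 1) (φ a) := by
    rw [crossAct, add_assoc, add_assoc, show (2 + 1 : Fin 3) = 0 from rfl, add_zero,
      show (2 + 2 : Fin 3) = 1 from rfl, hL.offdiag (show a ≠ a + 1 by simp)]
    module
  have h_I : Complex.I * (2 * Complex.I) = -2 := by
    linear_combination (2 : ℂ) * Complex.I_mul_I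
  rw [crossAct, cross_add_one, cross_add_two, sum_eq_add_cyclic _ a, map_smul, map_smul, smul_sub,
    smul_smul, smul_smul, mul_neg, h_I]
  linear_combination (norm := module) (-2 : ℂ) • hK.two_smul_apply_apply hL h a

/-- The symmetric tensor `K_a φ_b + K_b φ_a`. -/
def symTensor (K : Fin 3 → Module.End ℂ V) (φ : Fin 3 → V) (a b : Fin 3) : V :=
  K a (φ b) + K b (φ a)

theorem symTensor_comm (a b : Fin 3) : symTensor K φ a b = symTensor K φ b a :=
  add_comm _ _

section Tensor

variable {J : Fin 3 → Module.End ℂ V} (hJ : IsCrossCommutator J K K) (hφ : IsVectorUnder J φ)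
  (a : Fin 3)
include hJ hφ

theorem apply_symTensor_self_self : J a (symTensor K φ a a) = 0 := by
  rw [symTensor, map_add, hJ.apply_apply_self, hφ.apply_self, map_zero, add_zero]

theorem apply_symTensor_self_add_one :
    J a (symTensor K φ a (a + 1)) = Complex.I • symTensor K φ a (a + 2) := by
  simp only [symTensor, map_add, hJ.apply_apply_self, hJ.apply_apply_add_one, hφ.apply_self,
    hφ.apply_add_one, map_zero, map_smul, zero_add, smul_add]

theorem apply_symTensor_self_add_two :
    J a (symTensor K φ a (a + 2)) = -Complex.I • symTensor K φ a (a + 1) := by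
  simp only [symTensor, map_add, hJ.apply_apply_self, hJ.apply_apply_add_two, hφ.apply_self,
    hφ.apply_add_two, map_zero, map_smul, zero_add, smul_add]

theorem apply_symTensor_add_one_add_one :
    J a (symTensor K φ (a + 1) (a + 1)) =
      (2 * Complex.I) • symTensor K φ (a + 1) (a + 2) := by
  simp only [symTensor, map_add, hJ.apply_apply_add_one, hφ.apply_add_one, map_smul]
  module

theorem apply_symTensor_add_two_add_two :
    J a (symTensor K φ (a + 2) (a + 2)) =
      -((2 * Complex.I) • symTensor K φ (a + 1) (a + 2)) := by
  simp only [symTensor, map_add, hJ.apply_apply_add_two, hφ.apply_add_two, map_smul]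
  module

theorem apply_symTensor_add_one_add_two :
    J a (symTensor K φ (a + 1) (a + 2)) =
      Complex.I • (symTensor K φ (a + 2) (a + 2) - symTensor K φ (a + 1) (a + 1)) := by
  simp only [symTensor, map_add, hJ.apply_apply_add_one, hJ.apply_apply_add_two, hφ.apply_add_one,
    hφ.apply_add_two, map_smul]
  module

end Tensor

theorem symTensor_eq_zero_of_top {J : Fin 3 → Module.End ℂ V} (hJ : IsCrossCommutator J K K)
    (hφ : IsVectorUnder J φ) (h_top : symTensor K φ 0 0 - symTensor K φ 1 1 -
      (2 * Complex.I) • symTensor K φ 0 1 = 0) :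
    symTensor K φ 0 1 = 0 ∧ symTensor K φ 0 2 = 0 ∧ symTensor K φ 1 2 = 0 ∧
      symTensor K φ 0 0 = symTensor K φ 1 1 ∧ symTensor K φ 1 1 = symTensor K φ 2 2 := by
  have h00 := apply_symTensor_self_self hJ hφ 0
  have h01 := apply_symTensor_self_add_one hJ hφ 0
  have h02 := apply_symTensor_self_add_two hJ hφ 0
  have h11 := apply_symTensor_add_one_add_one hJ hφ 0
  have h22 := apply_symTensor_add_two_add_two hJ hφ 0
  have h12 := apply_symTensor_add_one_add_two hJ hφ 0
  simp only [zero_add] at h01 h02 h11 h22 h12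
  have cancel {c : ℂ} (hc : c ≠ 0) {v : V} (hv : (c * Complex.I) • v = 0) : v = 0 :=
    (smul_eq_zero_iff_right (mul_ne_zero hc Complex.I_ne_zero)).mp hv
  have h_second : symTensor K φ 1 2 + Complex.I • symTensor K φ 0 2 = 0 := by
    have h := congrArg (J 0) h_top
    simp only [map_sub, map_smul, map_zero, h00, h11, h01] at h
    exact cancel two_ne_zero (by linear_combination (norm := module) -h)
  have h_third : symTensor K φ 2 2 - symTensor K φ 1 1 - Complex.I • symTensor K φ 0 1 = 0 := by
    have h := congrArg (J 0) h_second
    simp only [map_add, map_smul, map_zero, h12, h02] at h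
    exact cancel one_ne_zero (by linear_combination (norm := module) h)
  have h_trace : symTensor K φ 0 0 + symTensor K φ 1 1 - (2 : ℂ) • symTensor K φ 2 2 = 0 := by
    linear_combination (norm := module) h_top - (2 : ℂ) • h_third
  have s12 : symTensor K φ 1 2 = 0 := by
    have h := congrArg (J 0) h_trace
    simp only [map_add, map_sub, map_smul, map_zero, h00, h11, h22] at h
    exact cancel (c := 6) (by norm_num) (by linear_combination (norm := module) h)
  have s02 : symTensor K φ 0 2 = 0 := by
    rw [s12, zero_add] at h_second
    exact (smul_eq_zero_iff_right Complex.I_ne_zero).mp h_second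
  have s01 : symTensor K φ 0 1 = 0 := by
    rw [s02, map_zero, eq_comm] at h02
    exact (smul_eq_zero_iff_right (neg_ne_zero.mpr Complex.I_ne_zero)).mp h02
  rw [s01, smul_zero, sub_zero] at h_top h_third
  exact ⟨s01, s02, s12, sub_eq_zero.mp h_top, (sub_eq_zero.mp h_third).symm⟩

theorem hasNoQuintet_of_apply_sub_eq_zero {J : Fin 3 → Module.End ℂ V}
    (hJ : IsCrossCommutator J K K) (hφ : IsVectorUnder J φ)
    (h : (K 0 - Complex.I • K 1) (φ 0 - Complex.I • φ 1) = 0) : HasNoQuintet K φ := by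
  have h_top : symTensor K φ 0 0 - symTensor K φ 1 1 - (2 * Complex.I) • symTensor K φ 0 1 = 0 := by
    simp only [LinearMap.sub_apply, LinearMap.smul_apply, map_sub, map_smul, smul_sub, smul_smul,
      Complex.I_mul_I] at h
    simp only [symTensor]
    linear_combination (norm := module) (2 : ℂ) • h
  obtain ⟨s01, s02, s12, h01, h12⟩ := symTensor_eq_zero_of_top hJ hφ h_top
  constructor
  · intro a b hab
    refine eq_neg_of_add_eq_zero_left (?_ : symTensor K φ a b = 0)
    fin_cases a <;> fin_cases b <;> first
      | exact absurd rfl hab | assumption | (rw [symTensor_comm]; assumption)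
  · have h_half (a b : Fin 3) (hab : symTensor K φ a a = symTensor K φ b b) :
        K a (φ a) = K b (φ b) := by
      simp only [symTensor] at hab
      linear_combination (norm := module) (1 / 2 : ℂ) • hab
    intro a b
    refine h_half a b ?_
    fin_cases a <;> fin_cases b <;> simp [h01, h12]

end Vector

/-! ### A spin coupled to its environment -/

theorem IsCrossCommutator.map {R R' : Type*} [Ring R] [Algebra ℂ R] [Ring R'] [Algebra ℂ R']
    {K L M : Fin 3 → R} (h : IsCrossCommutator K L M) (f : R →ₐ[ℂ] R') :
    IsCrossCommutator (f ∘ K) (f ∘ L) (f ∘ M) := by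
  have map_lie (x y : R) : ⁅f x, f y⁆ = f ⁅x, y⁆ := by
    rw [Ring.lie_def, Ring.lie_def, map_sub, map_mul, map_mul]
  refine ⟨fun a => ?_, fun a => ?_, fun a => ?_⟩
  · rw [Function.comp_apply, Function.comp_apply, map_lie, h.lie_self, map_zero]
  · rw [Function.comp_apply, Function.comp_apply, map_lie, h.lie_add_one, map_smul,
      Function.comp_apply]
  · rw [Function.comp_apply, Function.comp_apply, map_lie, h.lie_add_two, map_smul,
      Function.comp_apply]

theorem isCrossCommutator_spin : IsCrossCommutator spin spin spin := by
  have lie_add_one (a : Fin 3) : ⁅spin a, spin (a + 1)⁆ = Complex.I • spin (a + 2) := by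
    have h := sqrt_two_mul_self
    have hI := Complex.I_mul_I
    fin_cases a <;> ext i j <;> fin_cases i <;> fin_cases j <;>
      simp [Ring.lie_def, spin, sx, sy, sz, sp, sm] <;> grind
  refine ⟨fun a => by rw [Ring.lie_def, sub_self], lie_add_one, fun a => ?_⟩
  have h := lie_add_one (a + 2)
  rw [add_assoc, add_assoc, show (2 + 1 : Fin 3) = 0 from rfl, add_zero,
    show (2 + 2 : Fin 3) = 1 from rfl] at h
  rw [Ring.lie_def, ← neg_sub, ← Ring.lie_def, h, neg_smul]

section Environment

variable {N : ℕ}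

/-- The weighted total spin `∑_{β ≠ α} w_β 𝐒_β` of the environment of the site `α`. -/
noncomputable def envSpin (α : Fin N) (w : Fin N → ℂ) (a : Fin 3) : Op N :=
  ∑ β ∈ Finset.univ.erase α, w β • site β (spin a)

theorem isCrossCommutator_envSpin (α : Fin N) (w w' : Fin N → ℂ) :
    IsCrossCommutator (envSpin α w) (envSpin α w') (envSpin α (w * w')) := by
  refine ⟨fun a => ?_, fun a => ?_, fun a => ?_⟩
  · rw [envSpin, envSpin, lie_sum_smul_site]
    simp only [isCrossCommutator_spin.lie_self, site_zero, smul_zero, Finset.sum_const_zero]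
  · simp only [envSpin, lie_sum_smul_site, isCrossCommutator_spin.lie_add_one, site_smul,
      smul_comm _ Complex.I, ← Finset.smul_sum, Pi.mul_apply]
  · simp only [envSpin, lie_sum_smul_site, isCrossCommutator_spin.lie_add_two, site_smul,
      smul_comm _ (-Complex.I), ← Finset.smul_sum, Pi.mul_apply]

theorem site_commute_envSpin (α : Fin N) (A : Matrix (Fin 3) (Fin 3) ℂ) (w : Fin N → ℂ)
    (a : Fin 3) : Commute (site α A) (envSpin α w a) :=
  Commute.sum_right _ _ _ fun _ hβ =>
    (site_commute (Finset.ne_of_mem_erase hβ).symm A (spin a)).smul_right _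

/-- The coupling `∑_{β ≠ α} w_β 𝐒_α · 𝐒_β` of the spin at `α` to its environment. -/
noncomputable def dotEnv (α : Fin N) (w : Fin N → ℂ) : Op N :=
  ∑ β ∈ Finset.univ.erase α, w β • dotS α β

theorem dotS_eq_sum (α β : Fin N) : dotS α β = ∑ a, site α (spin a) * site β (spin a) := by
  rw [Fin.sum_univ_three]
  rfl

theorem dotEnv_eq_sum (α : Fin N) (w : Fin N → ℂ) :
    dotEnv α w = ∑ a, site α (spin a) * envSpin α w a := by
  simp only [dotEnv, envSpin, dotS_eq_sum, Finset.smul_sum, Finset.mul_sum, mul_smul_comm]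
  exact Finset.sum_comm

theorem sum_envSpin_mul_envSpin (α : Fin N) (w w' : Fin N → ℂ) :
    ∑ a, envSpin α w a * envSpin α w' a =
      ∑ β ∈ Finset.univ.erase α, ∑ γ ∈ Finset.univ.erase α, (w β * w' γ) • dotS β γ := by
  simp only [envSpin, dotS_eq_sum, Finset.sum_mul_sum, smul_mul_smul_comm, Finset.smul_sum]
  rw [Finset.sum_comm]
  exact Finset.sum_congr rfl fun β _ => Finset.sum_comm

/-- Row vectors picking the Cartesian components of a spin-one state: the components of
`|1,1⟩, |1,0⟩, |1,-1⟩` are those of `-(x + iy)`, `√2 z`, `x - iy`. -/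
noncomputable def cartesianBra : Fin 3 → Fin 3 → ℂ :=
  ![![-1, 0, 1], ![-Complex.I, 0, -Complex.I], ![0, (Real.sqrt 2 : ℂ), 0]]

theorem cartesianBra_vecMul_spin_self (a : Fin 3) : cartesianBra a ᵥ* spin a = 0 := by
  fin_cases a <;> ext i <;> fin_cases i <;>
      simp [cartesianBra, spin, sx, sy, sz, sp, sm, vecHead, vecTail]

theorem cartesianBra_vecMul_spin_add_one (a : Fin 3) :
    cartesianBra a ᵥ* spin (a + 1) = Complex.I • cartesianBra (a + 2) := by
  have h := sqrt_two_mul_self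
  have := Complex.I_mul_I
  fin_cases a <;> ext i <;> fin_cases i <;>
    simp [cartesianBra, spin, sx, sy, sz, sp, sm, vecHead, vecTail] <;> grind

theorem cartesianBra_vecMul_spin_add_two (a : Fin 3) :
    cartesianBra a ᵥ* spin (a + 2) = -Complex.I • cartesianBra (a + 1) := by
  have h := sqrt_two_mul_self
  have := Complex.I_mul_I
  fin_cases a <;> ext i <;> fin_cases i <;>
    simp [cartesianBra, spin, sx, sy, sz, sp, sm, vecHead, vecTail] <;> grind

/-- The operator selecting the `a`-th Cartesian component of the spin at `α`. Its value does not
depend on the state of that spin any more. -/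
noncomputable def cartesian (α : Fin N) (a : Fin 3) : Op N :=
  site α (replicateRow (Fin 3) (cartesianBra a))

theorem cartesian_mulVec (α : Fin N) (a : Fin 3) (ψ : State N) (s : Config N) :
    (cartesian α a *ᵥ ψ) s = ∑ m, cartesianBra a m * ψ (Function.update s α m) :=
  site_mulVec ..

theorem eq_zero_of_cartesian_mulVec {α : Fin N} {ψ : State N} (h : ∀ a, cartesian α a *ᵥ ψ = 0) :
    ψ = 0 := by
  ext s
  have h_component (a : Fin 3) := congrFun (h a) s
  simp only [cartesian_mulVec, Pi.zero_apply] at h_component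
  have hx := h_component 0
  have hy := h_component 1
  have hz := h_component 2
  simp [cartesianBra, Fin.sum_univ_three] at hx hy hz
  have := Complex.I_mul_I
  have h_all (m : Fin 3) : ψ (Function.update s α m) = 0 := by fin_cases m <;> grind
  rw [← Function.update_eq_self α s, h_all, Pi.zero_apply]

theorem commute_cartesian_envSpin (α : Fin N) (a b : Fin 3) (w : Fin N → ℂ) :
    Commute (cartesian α a) (envSpin α w b) :=
  site_commute_envSpin α _ w b

theorem cartesian_mul_site (α : Fin N) (a : Fin 3) (A : Matrix (Fin 3) (Fin 3) ℂ) :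
    cartesian α a * site α A = site α (replicateRow (Fin 3) (cartesianBra a ᵥ* A)) := by
  rw [cartesian, site_mul, replicateRow_vecMul]

theorem cartesian_mul_site_spin_self (α : Fin N) (a : Fin 3) :
    cartesian α a * site α (spin a) = 0 := by
  rw [cartesian_mul_site, cartesianBra_vecMul_spin_self, replicateRow_zero, site_zero]

theorem cartesian_mul_site_spin_add_one (α : Fin N) (a : Fin 3) :
    cartesian α a * site α (spin (a + 1)) = Complex.I • cartesian α (a + 2) := by
  rw [cartesian_mul_site, cartesianBra_vecMul_spin_add_one, replicateRow_smul, site_smul,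
    cartesian]

theorem cartesian_mul_site_spin_add_two (α : Fin N) (a : Fin 3) :
    cartesian α a * site α (spin (a + 2)) = -Complex.I • cartesian α (a + 1) := by
  rw [cartesian_mul_site, cartesianBra_vecMul_spin_add_two, replicateRow_smul, site_smul,
    cartesian]

/-- The weighted spin of the environment of `α`, as linear endomorphisms. -/
noncomputable def envEnd (α : Fin N) (w : Fin N → ℂ) (a : Fin 3) : Module.End ℂ (State N) :=
  Matrix.toLinAlgEquiv' (envSpin α w a)

theorem envEnd_apply (α : Fin N) (w : Fin N → ℂ) (a : Fin 3) (ψ : State N) :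
    envEnd α w a ψ = envSpin α w a *ᵥ ψ :=
  Matrix.toLinAlgEquiv'_apply ..

theorem isCrossCommutator_envEnd (α : Fin N) (w w' : Fin N → ℂ) :
    IsCrossCommutator (envEnd α w) (envEnd α w') (envEnd α (w * w')) :=
  (isCrossCommutator_envSpin α w w').map Matrix.toLinAlgEquiv'.toAlgHom

theorem envEnd_cartesian_mulVec (α : Fin N) (w : Fin N → ℂ) (a b : Fin 3) (ψ : State N) :
    envEnd α w a (cartesian α b *ᵥ ψ) = (cartesian α b * envSpin α w a) *ᵥ ψ := by
  rw [envEnd_apply, mulVec_mulVec, (commute_cartesian_envSpin α b a w).eq]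

theorem cartesian_mulVec_dotEnv_mulVec (α : Fin N) (w : Fin N → ℂ) (a : Fin 3) (ψ : State N) :
    cartesian α a *ᵥ (dotEnv α w *ᵥ ψ) = crossAct (envEnd α w) (fun b => cartesian α b *ᵥ ψ) a := by
  rw [mulVec_mulVec, dotEnv_eq_sum, sum_eq_add_cyclic _ a, mul_add, mul_add, ← mul_assoc,
    ← mul_assoc, ← mul_assoc, cartesian_mul_site_spin_self, cartesian_mul_site_spin_add_one,
    cartesian_mul_site_spin_add_two, zero_mul, zero_add, crossAct, envEnd_cartesian_mulVec,
    envEnd_cartesian_mulVec, add_mulVec, smul_mul_assoc, smul_mul_assoc, smul_mulVec, smul_mulVec]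
  module

theorem IsSinglet.envSpin_one_mulVec {ψ : State N} (hψ : IsSinglet ψ) (α : Fin N) (a : Fin 3) :
    envSpin α 1 a *ᵥ ψ = -(site α (spin a) *ᵥ ψ) := by
  have h := hψ a
  rw [← Finset.add_sum_erase _ _ (Finset.mem_univ α), add_mulVec] at h
  simpa only [envSpin, Pi.one_apply, one_smul] using eq_neg_of_add_eq_zero_right h

theorem IsSinglet.isVectorUnder {ψ : State N} (hψ : IsSinglet ψ) (α : Fin N) :
    IsVectorUnder (envEnd α 1) fun a => cartesian α a *ᵥ ψ := by
  have h (a b : Fin 3) : envEnd α 1 a (cartesian α b *ᵥ ψ) =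
      -((cartesian α b * site α (spin a)) *ᵥ ψ) := by
    rw [envEnd_cartesian_mulVec, ← mulVec_mulVec, hψ.envSpin_one_mulVec, mulVec_neg, mulVec_mulVec]
  refine ⟨fun a => ?_, fun a => ?_, fun a => ?_⟩
  · rw [h, cartesian_mul_site_spin_self, zero_mulVec, neg_zero]
  · have h_cyclic := cartesian_mul_site_spin_add_two α (a + 1)
    rw [add_assoc, add_assoc, show (1 + 2 : Fin 3) = 0 from rfl, add_zero,
      show (1 + 1 : Fin 3) = 2 from rfl] at h_cyclic
    rw [h, h_cyclic, smul_mulVec, neg_smul, neg_neg]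
  · have h_cyclic := cartesian_mul_site_spin_add_one α (a + 2)
    rw [add_assoc, add_assoc, show (2 + 1 : Fin 3) = 0 from rfl, add_zero,
      show (2 + 2 : Fin 3) = 1 from rfl] at h_cyclic
    rw [h, h_cyclic, smul_mulVec, neg_smul]

theorem cartesianBra_sub_smul_cartesianBra :
    cartesianBra 0 - Complex.I • cartesianBra 1 = ![0, 0, -1] ᵥ* (sm * sm) := by
  have h := sqrt_two_mul_self
  ext i
  fin_cases i <;> simp [cartesianBra, sm, h]
  norm_num

theorem cartesian_sub_smul_cartesian (α : Fin N) :
    cartesian α 0 - Complex.I • cartesian α 1 =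
      site α (replicateRow (Fin 3) ![0, 0, -1]) * Sm α ^ 2 := by
  rw [Sm, sq, site_mul, site_mul, ← replicateRow_vecMul, ← cartesianBra_sub_smul_cartesianBra,
    cartesian, cartesian, ← site_smul, ← site_sub]
  rfl

theorem sm_eq_spin_sub : sm = spin 0 - Complex.I • spin 1 := by
  have h : Complex.I * (1 / (2 * Complex.I)) = 1 / 2 := by field_simp
  simp only [spin, sx, sy, cons_val_zero, cons_val_one, smul_smul, h]
  module

theorem envSpin_sub_smul_envSpin (α : Fin N) (w : Fin N → ℂ) :
    envSpin α w 0 - Complex.I • envSpin α w 1 = ∑ β ∈ Finset.univ.erase α, w β • Sm β := by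
  simp only [envSpin, Finset.smul_sum, ← Finset.sum_sub_distrib, smul_comm Complex.I, ← smul_sub,
    ← site_smul, ← site_sub, ← sm_eq_spin_sub, Sm]

/-- The assumption says that the lowest component of the spin-two part vanishes; as the total state
is a singlet, rotations generate all other components from it. -/
theorem hasNoQuintet_of_sum_mulVec_eq_zero {α : Fin N} {w : Fin N → ℂ} {ψ : State N}
    (hψ : IsSinglet ψ)
    (h : (∑ β ∈ Finset.univ.erase α, w β • (Sm α ^ 2 * Sm β)) *ᵥ ψ = 0) :
    HasNoQuintet (envEnd α w) fun a => cartesian α a *ᵥ ψ := by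
  have hJ := isCrossCommutator_envEnd α 1 w
  rw [one_mul] at hJ
  refine hasNoQuintet_of_apply_sub_eq_zero hJ (hψ.isVectorUnder α) ?_
  have h_lower : (cartesian α 0 - Complex.I • cartesian α 1) *
      (envSpin α w 0 - Complex.I • envSpin α w 1) =
        site α (replicateRow (Fin 3) ![0, 0, -1]) *
          ∑ β ∈ Finset.univ.erase α, w β • (Sm α ^ 2 * Sm β) := by
    rw [cartesian_sub_smul_cartesian, envSpin_sub_smul_envSpin, mul_assoc, Finset.mul_sum]
    simp only [mul_smul_comm]
  calc (envEnd α w 0 - Complex.I • envEnd α w 1)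
        (cartesian α 0 *ᵥ ψ - Complex.I • (cartesian α 1 *ᵥ ψ))
      = ((cartesian α 0 - Complex.I • cartesian α 1) *
          (envSpin α w 0 - Complex.I • envSpin α w 1)) *ᵥ ψ := by
        simp only [LinearMap.sub_apply, LinearMap.smul_apply, map_sub, map_smul,
          envEnd_cartesian_mulVec, sub_mul, mul_sub, smul_mul_assoc, mul_smul_comm, sub_mulVec,
          smul_mulVec]
        module
    _ = 0 := by rw [h_lower, ← mulVec_mulVec, h, mulVec_zero]

theorem dotEnv_mulVec_dotEnv_mulVec {α : Fin N} {w w' : Fin N → ℂ} {ψ : State N}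
    (h : HasNoQuintet (envEnd α w) fun a => cartesian α a *ᵥ ψ)
    (h' : HasNoQuintet (envEnd α w') fun a => cartesian α a *ᵥ ψ) :
    dotEnv α w *ᵥ (dotEnv α w' *ᵥ ψ) =
      (4 : ℂ) • ((∑ β ∈ Finset.univ.erase α, ∑ γ ∈ Finset.univ.erase α,
        (w β * w' γ) • dotS β γ) *ᵥ ψ) + (2 : ℂ) • (dotEnv α (w * w') *ᵥ ψ) := by
  refine sub_eq_zero.mp (eq_zero_of_cartesian_mulVec (α := α) fun a => ?_)
  have h_env : cartesian α a *ᵥ ((∑ β ∈ Finset.univ.erase α, ∑ γ ∈ Finset.univ.erase α,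
      (w β * w' γ) • dotS β γ) *ᵥ ψ) = ∑ b, envEnd α w b (envEnd α w' b (cartesian α a *ᵥ ψ)) := by
    rw [← sum_envSpin_mul_envSpin, mulVec_mulVec, Finset.mul_sum, sum_mulVec]
    refine Finset.sum_congr rfl fun b _ => ?_
    rw [envEnd_apply, envEnd_apply, mulVec_mulVec, mulVec_mulVec,
      ((commute_cartesian_envSpin α a b w).mul_right (commute_cartesian_envSpin α a b w')).eq]
  have h_cross := crossAct_crossAct (isCrossCommutator_envEnd α w w') h h' a
  simp only [mulVec_sub, mulVec_add, mulVec_smul, h_env, cartesian_mulVec_dotEnv_mulVec]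
  rw [h_cross, sub_self]

end Environment

/-! ### The Hamiltonian -/

section Hamiltonian

variable {N : ℕ}

/-- The coefficients `1 / (η_α - η_β)` of the chain. -/
noncomputable def invSub (α β : Fin N) : ℂ := 1 / (eta N α - eta N β)

/-- The complex conjugates of `invSub`. -/
noncomputable def conjInvSub (α β : Fin N) : ℂ := 1 / (conj (eta N α) - conj (eta N β))

theorem invSub_swap (α β : Fin N) : invSub α β = -invSub β α := by
  rw [invSub, invSub, ← neg_sub (eta N β), div_neg]

theorem conjInvSub_eq (α β : Fin N) : conjInvSub α β = -eta N α * (invSub α β * eta N β) :=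
  one_div_conj_eta_sub α β

theorem conjInvSub_mul_invSub (α β : Fin N) :
    conjInvSub α β * invSub α β = 1 / ((‖eta N α - eta N β‖ ^ 2 : ℝ) : ℂ) := by
  rw [conjInvSub, invSub, _root_.one_div_mul_one_div, ← map_sub, Complex.conj_mul',
    Complex.ofReal_pow]

theorem hamiltonian_eq (N : ℕ) : hamiltonian N = (2 * (Real.pi : ℂ) ^ 2 / (N : ℂ) ^ 2) • ∑ α,
    (dotEnv α (conjInvSub α * invSub α) - (1 / 20 : ℂ) •
      (dotEnv α (conjInvSub α) * dotEnv α (invSub α) +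
        dotEnv α (invSub α) * dotEnv α (conjInvSub α))) := by
  rw [hamiltonian, Finset.sum_sub_distrib, ← Finset.smul_sum]
  congr 3
  · simp only [dotEnv, Pi.mul_apply, conjInvSub_mul_invSub]
  · refine Finset.sum_congr rfl fun α _ => ?_
    have h_swap : dotEnv α (invSub α) * dotEnv α (conjInvSub α) =
        ∑ β ∈ Finset.univ.erase α, ∑ γ ∈ Finset.univ.erase α,
          (invSub α γ • dotS α γ) * (conjInvSub α β • dotS α β) := by
      rw [dotEnv, dotEnv, Finset.sum_mul_sum, Finset.sum_comm]
    rw [h_swap, dotEnv, dotEnv, Finset.sum_mul_sum]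
    simp only [← Finset.sum_add_distrib]
    refine Finset.sum_congr rfl fun β _ => Finset.sum_congr rfl fun γ _ => ?_
    rw [smul_mul_smul_comm, smul_mul_smul_comm, mul_comm (invSub α γ), ← smul_add, conjInvSub,
      invSub, _root_.one_div_mul_one_div]

/-- The coefficient of `𝐒_β · 𝐒_γ` left after summing over the central site `α` of the three-site
terms. -/
noncomputable def pairSum (β γ : Fin N) : ℂ :=
  ∑ α ∈ (Finset.univ.erase β).erase γ, conjInvSub α β * invSub α γ

theorem pairSum_self (β : Fin N) : pairSum β β = ((N : ℂ) ^ 2 - 1) / 12 := by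
  have h_term (α : Fin N) : conjInvSub α β * invSub α β =
      -eta N β * ((1 / (eta N β - eta N α)) ^ 2 * eta N α ^ 1) := by
    rw [conjInvSub_eq, invSub_swap, invSub]
    ring
  have h_β := eta_ne_zero β
  rw [pairSum, Finset.erase_idem, Finset.sum_congr rfl fun α _ => h_term α, ← Finset.mul_sum,
    sum_eta_pow_div_sq β le_rfl (by omega)]
  push_cast
  field_simp
  ring

theorem sum_erase_erase_invSub_mul_eta {β γ : Fin N} (h : γ ≠ β) :
    ∑ α ∈ (Finset.univ.erase β).erase γ, invSub β α * eta N α =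
      (1 - (N : ℂ)) / 2 - invSub β γ * eta N γ := by
  have h_all := sum_eta_pow_div β (k := 1) le_rfl β.pos
  simp only [pow_one] at h_all
  have h_β := eta_ne_zero β
  rw [Finset.sum_erase_eq_sub (Finset.mem_erase.mpr ⟨h, Finset.mem_univ γ⟩)]
  simp only [invSub, h_all]
  push_cast
  field_simp
  ring

theorem pairSum_of_ne {β γ : Fin N} (h : γ ≠ β) :
    pairSum β γ = -eta N β * (eta N β + eta N γ) * invSub β γ ^ 2 := by
  have h_βγ := eta_sub_ne_zero h
  have h_partial_fractions {α : Fin N} (hα : α ∈ (Finset.univ.erase β).erase γ) :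
      conjInvSub α β * invSub α γ =
        eta N β * invSub β γ * (invSub β α * eta N α - invSub γ α * eta N α) := by
    have h_β := eta_sub_ne_zero (Finset.ne_of_mem_erase (Finset.mem_of_mem_erase hα))
    have h_γ := eta_sub_ne_zero (Finset.ne_of_mem_erase hα)
    rw [conjInvSub_eq, invSub_swap α β, invSub_swap α γ, invSub, invSub, invSub]
    field_simp
    ring
  rw [pairSum, Finset.sum_congr rfl fun α hα => h_partial_fractions hα, ← Finset.mul_sum,
    Finset.sum_sub_distrib, sum_erase_erase_invSub_mul_eta h, Finset.erase_right_comm,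
    sum_erase_erase_invSub_mul_eta h.symm, invSub_swap γ β]
  ring

theorem pairSum_add_pairSum {β γ : Fin N} (h : γ ≠ β) :
    pairSum β γ + pairSum γ β = 4 * (conjInvSub β γ * invSub β γ) - 1 := by
  have h_βγ := eta_sub_ne_zero h
  rw [pairSum_of_ne h, pairSum_of_ne h.symm, conjInvSub_eq, invSub_swap γ β, invSub]
  field_simp
  ring

theorem dotS_self (β : Fin N) : dotS β β = (2 : ℂ) • (1 : Op N) := by
  have h_casimir : sx * sx + sy * sy + sz * sz = (2 : ℂ) • 1 := by
    have h := sqrt_two_mul_self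
    ext i j
    fin_cases i <;> fin_cases j <;> simp [sx, sy, sz, sp, sm] <;> grind [Complex.I_mul_I]
  rw [dotS, Sx, Sy, Sz, site_mul, site_mul, site_mul, ← site_add, ← site_add, h_casimir,
    site_smul, site_one]

theorem IsSinglet.sum_dotS_mulVec {ψ : State N} (hψ : IsSinglet ψ) :
    (∑ β, ∑ γ, dotS β γ) *ᵥ ψ = 0 := by
  have h_square : (∑ β : Fin N, ∑ γ : Fin N, dotS β γ) =
      ∑ a, (∑ β, site β (spin a)) * ∑ γ, site γ (spin a) := by
    simp only [dotS_eq_sum, Finset.sum_mul_sum]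
    exact (Finset.sum_congr rfl fun β _ => Finset.sum_comm).trans Finset.sum_comm
  rw [h_square, sum_mulVec]
  exact Finset.sum_eq_zero fun a _ => by rw [← mulVec_mulVec, hψ a, mulVec_zero]

theorem sum_pairSum_smul_dotS (N : ℕ) :
    ∑ β : Fin N, ∑ γ, (pairSum β γ + pairSum γ β) • dotS β γ =
      (4 : ℂ) • ∑ α, dotEnv α (conjInvSub α * invSub α) +
        ((N : ℂ) * (N ^ 2 + 5) / 3) • (1 : Op N) - ∑ β, ∑ γ, dotS β γ := by
  have h_row (β : Fin N) : ∑ γ, (pairSum β γ + pairSum γ β) • dotS β γ =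
      (4 : ℂ) • dotEnv β (conjInvSub β * invSub β) + (((N : ℂ) ^ 2 + 5) / 3) • (1 : Op N) -
        ∑ γ, dotS β γ := by
    have h_off : ∑ γ ∈ Finset.univ.erase β, (pairSum β γ + pairSum γ β) • dotS β γ =
        (4 : ℂ) • dotEnv β (conjInvSub β * invSub β) - ∑ γ ∈ Finset.univ.erase β, dotS β γ := by
      rw [dotEnv, Finset.smul_sum, ← Finset.sum_sub_distrib]
      refine Finset.sum_congr rfl fun γ hγ => ?_
      rw [pairSum_add_pairSum (Finset.ne_of_mem_erase hγ), sub_smul, one_smul, mul_smul,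
        Pi.mul_apply]
    rw [← Finset.add_sum_erase _ _ (Finset.mem_univ β),
      ← Finset.add_sum_erase _ (dotS β) (Finset.mem_univ β), h_off, pairSum_self, dotS_self]
    module
  rw [Finset.sum_congr rfl fun β _ => h_row β, Finset.sum_sub_distrib, Finset.sum_add_distrib,
    ← Finset.smul_sum, Finset.sum_const, Finset.card_univ, Fintype.card_fin,
    ← Nat.cast_smul_eq_nsmul ℂ, smul_smul, mul_div_assoc]

theorem sum_erase_smul_dotS (F G : Fin N → Fin N → ℂ) :
    ∑ α, ∑ β ∈ Finset.univ.erase α, ∑ γ ∈ Finset.univ.erase α, (F α β * G α γ) • dotS β γ =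
      ∑ β, ∑ γ, (∑ α ∈ (Finset.univ.erase β).erase γ, F α β * G α γ) • dotS β γ := by
  simp only [Finset.sum_smul]
  rw [Finset.sum_comm' (t' := Finset.univ) (s' := fun β => Finset.univ.erase β)
    (by simp [ne_comm])]
  refine Finset.sum_congr rfl fun β _ => Finset.sum_comm' fun α γ => ?_
  simp only [Finset.mem_erase, Finset.mem_univ]
  tauto

theorem sum_anticomm_dotEnv_mulVec {ψ : State N} (hψ : IsSinglet ψ)
    (hΩ : ∀ α, Omega N α *ᵥ ψ = 0) (hΩbar : ∀ α, OmegaBar N α *ᵥ ψ = 0) :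
    (∑ α, (dotEnv α (conjInvSub α) * dotEnv α (invSub α) +
      dotEnv α (invSub α) * dotEnv α (conjInvSub α))) *ᵥ ψ =
      (4 : ℂ) • ((∑ β, ∑ γ, (pairSum β γ + pairSum γ β) • dotS β γ) *ᵥ ψ +
        (∑ α, dotEnv α (conjInvSub α * invSub α)) *ᵥ ψ) := by
  have h_swap (β γ : Fin N) : pairSum γ β =
      ∑ α ∈ (Finset.univ.erase β).erase γ, invSub α β * conjInvSub α γ := by
    simp only [pairSum, Finset.erase_right_comm (a := γ), mul_comm]
  have h_pair : ∑ β : Fin N, ∑ γ, (pairSum β γ + pairSum γ β) • dotS β γ =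
      ∑ α, (∑ β ∈ Finset.univ.erase α, ∑ γ ∈ Finset.univ.erase α,
          (conjInvSub α β * invSub α γ) • dotS β γ +
        ∑ β ∈ Finset.univ.erase α, ∑ γ ∈ Finset.univ.erase α,
          (invSub α β * conjInvSub α γ) • dotS β γ) := by
    rw [Finset.sum_add_distrib, sum_erase_smul_dotS conjInvSub invSub,
      sum_erase_smul_dotS invSub conjInvSub]
    simp only [add_smul, Finset.sum_add_distrib, ← h_swap, pairSum]
  have h_quintet (α : Fin N) := hasNoQuintet_of_sum_mulVec_eq_zero hψ (hΩ α)
  have h_quintet_bar (α : Fin N) := hasNoQuintet_of_sum_mulVec_eq_zero hψ (hΩbar α)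
  rw [h_pair, sum_mulVec, sum_mulVec, sum_mulVec, ← Finset.sum_add_distrib, Finset.smul_sum]
  refine Finset.sum_congr rfl fun α _ => ?_
  rw [add_mulVec, ← mulVec_mulVec, ← mulVec_mulVec,
    dotEnv_mulVec_dotEnv_mulVec (w := conjInvSub α) (w' := invSub α) (h_quintet_bar α)
      (h_quintet α),
    dotEnv_mulVec_dotEnv_mulVec (w := invSub α) (w' := conjInvSub α) (h_quintet α)
      (h_quintet_bar α), mul_comm (invSub α) (conjInvSub α), add_mulVec]
  module

theorem hamiltonian_mulVec {ψ : State N} (hψ : IsSinglet ψ) (hΩ : ∀ α, Omega N α *ᵥ ψ = 0)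
    (hΩbar : ∀ α, OmegaBar N α *ᵥ ψ = 0) :
    hamiltonian N *ᵥ ψ =
      (2 * (Real.pi : ℂ) ^ 2 / (N : ℂ) ^ 2 * -((N : ℂ) * (N ^ 2 + 5) / 15)) • ψ := by
  rw [hamiltonian_eq, smul_mulVec, mul_smul, Finset.sum_sub_distrib, ← Finset.smul_sum, sub_mulVec,
    smul_mulVec, sum_anticomm_dotEnv_mulVec hψ hΩ hΩbar, sum_pairSum_smul_dotS, sub_mulVec,
    hψ.sum_dotS_mulVec, add_mulVec, smul_mulVec, smul_mulVec, one_mulVec]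
  module

end Hamiltonian

end PfaffianChain

theorem mainTheorem6 (n : ℕ) (hn : 0 < n) :
    Module.End.HasEigenvector
        (Matrix.toLin' (PfaffianChain.hamiltonian (2 * n)))
        ((-(2 * Real.pi ^ 2 / 15) * (((2 * n : ℕ) : ℝ) + 5 / ((2 * n : ℕ) : ℝ)) : ℝ) : ℂ)
        (PfaffianChain.psi0 n) ∧
      (∀ α : Fin (2 * n),
        PfaffianChain.Omega (2 * n) α *ᵥ PfaffianChain.psi0 n = 0 ∧
        PfaffianChain.OmegaBar (2 * n) α *ᵥ PfaffianChain.psi0 n = 0) ∧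
      (∀ α : Fin (2 * n),
        PfaffianChain.Xi (2 * n) α *ᵥ PfaffianChain.psi0 n = 0 ∧
        PfaffianChain.XiBar (2 * n) α *ᵥ PfaffianChain.psi0 n = 0) := by
  refine ⟨⟨Module.End.mem_eigenspace_iff.mpr ?_, PfaffianChain.psi0_ne_zero n⟩,
    fun α => ⟨PfaffianChain.Omega_mulVec_psi0 n α, PfaffianChain.OmegaBar_mulVec_psi0 n α⟩,
    fun α => ⟨PfaffianChain.Xi_mulVec_psi0 n α, PfaffianChain.XiBar_mulVec_psi0 n α⟩⟩
  rw [Matrix.toLin'_apply, PfaffianChain.hamiltonian_mulVec (PfaffianChain.isSinglet_psi0 n)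
    (PfaffianChain.Omega_mulVec_psi0 n) (PfaffianChain.OmegaBar_mulVec_psi0 n)]
  congr 1
  have hn_ne : (n : ℂ) ≠ 0 := Nat.cast_ne_zero.mpr hn.ne'
  push_cast
  field_simp
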